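/- Let $1\le p\le\infty$ and $\sigma>0$. For $1\le p<\infty$ let $X^p=X^p(\mathbb R_+)$ be the space of measurable functions $f:\mathbb R_+\to\mathbb C$ (identified when equal almost everywhere) with $\|f\|_{X^p}=\|f(x)x^{-1/p}\|_{L^p(\mathbb R_+)}<\infty$, and let $X^\infty$ be the space of measurable functions with $\|f\|_{X^\infty}=\sup_{x>0}|f(x)|<\infty$. Let $U(t)f(x)=f(e^tx)$, and let $\Theta$ be its infinitesimal generator in $X^p$: $\Theta f=g$ if $f,g\in X^p$ and $(U(t)f-f)/t\to g$ in $X^p$ as $t\to0$; on smooth functions in its domain $\Theta=x\frac{d}{dx}$. The Bernstein space $\mathbf B_\sigma^p(\Theta)$ is the set of all $f\in X^p$ that belong to the domain of $\Theta^k$ for all $k\in\mathbb N$ and satisfy $\|\Theta^kf\|_{X^p}\le\sigma^k\|f\|_{X^p}$ for all $k\in\mathbb N$. Put $\operatorname{sinc}(x)=\frac{\sin\pi x}{\pi x}$, $\operatorname{sinc}(0)=1$, and for $m\ge1$ let $A_{m,k}=(-1)^{k+1}\operatorname{sinc}^{(2m-1)}(\tfrac12-k)$ for $k\in\mathbb Z$,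 $B_{m,k}=(-1)^{k+1}\operatorname{sinc}^{(2m)}(-k)$ for $k\in\mathbb Z\setminus\{0\}$, and $B_{m,0}=(-1)^{m+1}\frac{\pi^{2m}}{2m+1}$. For $m\ge 1$ define $$\mathcal R^{(2m-1)}(\sigma)f(x)=\Big(\frac{\sigma}{\pi}\Big)^{2m-1}\sum_{k\in\mathbb Z}(-1)^{k+1}A_{m,k}\,f\big(e^{\frac{\pi}{\sigma}(k-\frac12)}x\big),\qquad \mathcal R^{(2m)}(\sigma)f(x)=\Big(\frac{\sigma}{\pi}\Big)^{2m}\sum_{k\in\mathbb Z}(-1)^{k+1}B_{m,k}\,f\big(e^{\frac{\pi k}{\sigma}}x\big),$$ as series converging in $X^p$. **Theorem.** For $f\in X^p$ the following conditions are equivalent: 1. $f\in\mathbf B_\sigma^p(\Theta)$; 2. for every integer $r\ge1$, $f$ is in the domain of $\Theta^r$ and $\Theta^rf=\mathcal R^{(r)}(\sigma)f$ in $X^p$; 3. $f$ is equal in $X^p$ (almost everywhere if $p<\infty$, everywhere if $p=\infty$) to a function $F\in C^\infty(\mathbb R_+)$ such that for every integer $r\ge1$ and every $x>0$ one has $\left(x\frac{d}{dx}\right)^rF(x)=\mathcal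 R^{(r)}(\sigma)F(x)$, where the series converges absolutely at every point of $\mathbb R_+$ and uniformly on $\mathbb R_+$. -/

import Mathlib

open Set Filter Topology MeasureTheory

noncomputable section

namespace MellinBernstein

open scoped ENNReal

/-- The norm of `X^p(ℝ₊)`: for `p < ∞` it is the `L^p(ℝ₊)`-norm of `x ↦ f x * x ^ (-1/p)`,
for `p = ∞` it is the supremum of `|f x|` over `x > 0` (a supremum, not an essential supremum).
Functions on `ℝ₊` are functions on `ℝ` of which only the values on `Ioi 0` are ever used. -/
def XNorm (p : ℝ≥0∞) (f : ℝ → ℂ) : ℝ≥0∞ :=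
  if p = ∞ then ⨆ x ∈ Ioi (0 : ℝ), ‖f x‖ₑ
  else eLpNorm (fun x : ℝ => f x * ((x ^ (-(1 / p.toReal)) : ℝ) : ℂ)) p
    (volume.restrict (Ioi (0 : ℝ)))

/-- Membership in `X^p(ℝ₊)`: `f` is Lebesgue measurable on `ℝ₊` and has finite norm. -/
def MemX (p : ℝ≥0∞) (f : ℝ → ℂ) : Prop :=
  AEStronglyMeasurable f (volume.restrict (Ioi (0 : ℝ))) ∧ XNorm p f < ∞

/-- Equality of two elements of `X^p(ℝ₊)`: almost everywhere for `p < ∞`, everywhere on `ℝ₊`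
for `p = ∞`. -/
def XEq (p : ℝ≥0∞) (f g : ℝ → ℂ) : Prop :=
  XNorm p (fun x => f x - g x) = 0

/-- The Mellin translation `U(t) f (x) = f (e^t x)`. -/
def mellinShift (t : ℝ) (f : ℝ → ℂ) : ℝ → ℂ :=
  fun x => f (Real.exp t * x)

/-- `f` is in the domain of the infinitesimal generator `Θ` of the group `U` in `X^p(ℝ₊)`, and
`Θ f = g`, that is, `(U(t) f - f) / t → g` in the norm of `X^p(ℝ₊)` as `t → 0`. -/
def IsTheta (p : ℝ≥0∞) (f g : ℝ → ℂ) : Prop :=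
  MemX p f ∧ MemX p g ∧
    Tendsto (fun t : ℝ => XNorm p (fun x => (mellinShift t f x - f x) / (t : ℂ) - g x))
      (𝓝[≠] 0) (𝓝 0)

/-- `f` is in the domain of the power `Θ^k` in `X^p(ℝ₊)`, and `Θ^k f = g`. -/
def IsThetaPow (p : ℝ≥0∞) : ℕ → (ℝ → ℂ) → (ℝ → ℂ) → Prop
  | 0, f, g => MemX p f ∧ MemX p g ∧ XEq p f g
  | k + 1, f, g => ∃ h : ℝ → ℂ, IsThetaPow p k f h ∧ IsTheta p h g

/-- The Bernstein space `B_σ^p(Θ)`: all `f` in `X^p(ℝ₊)` that are in the domain of every power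
of `Θ` and satisfy `‖Θ^k f‖ ≤ σ^k ‖f‖` for all `k`. -/
def MemBernstein (σ : ℝ) (p : ℝ≥0∞) (f : ℝ → ℂ) : Prop :=
  MemX p f ∧ ∀ k : ℕ, ∃ g : ℝ → ℂ,
    IsThetaPow p k f g ∧ XNorm p g ≤ ENNReal.ofReal (σ ^ k) * XNorm p f

/-- The classical differential operator `x d/dx`. -/
def xddx (f : ℝ → ℂ) : ℝ → ℂ :=
  fun x => (x : ℂ) * deriv f x

/-- The normalized cardinal sine `sin (π x) / (π x)`, equal to `1` at `0`. -/
def sincN (x : ℝ) : ℝ :=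
  Real.sinc (Real.pi * x)

/-- `A_{m,k} = (-1)^{k+1} sinc^{(2m-1)}(1/2 - k)`, for `m ≥ 1`. -/
def coeffA (m : ℕ) (k : ℤ) : ℝ :=
  (-1 : ℝ) ^ (k + 1) * iteratedDeriv (2 * m - 1) sincN (1 / 2 - (k : ℝ))

/-- `B_{m,k} = (-1)^{k+1} sinc^{(2m)}(-k)` for `k ≠ 0`, and `B_{m,0} = (-1)^{m+1} π^{2m}/(2m+1)`,
for `m ≥ 1`. -/
def coeffB (m : ℕ) (k : ℤ) : ℝ :=
  if k = 0 then (-1 : ℝ) ^ (m + 1) * (Real.pi ^ (2 * m) / (2 * (m : ℝ) + 1))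
  else (-1 : ℝ) ^ (k + 1) * iteratedDeriv (2 * m) sincN (-(k : ℝ))

/-- The `k`-th term of the series of order `2m - 1`. -/
def termOdd (m : ℕ) (σ : ℝ) (f : ℝ → ℂ) (k : ℤ) (x : ℝ) : ℂ :=
  (((σ / Real.pi) ^ (2 * m - 1) * ((-1 : ℝ) ^ (k + 1) * coeffA m k) : ℝ) : ℂ) *
    f (Real.exp (Real.pi / σ * ((k : ℝ) - 1 / 2)) * x)

/-- The `k`-th term of the series of order `2m`. -/
def termEven (m : ℕ) (σ : ℝ) (f : ℝ → ℂ) (k : ℤ) (x : ℝ) : ℂ :=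
  (((σ / Real.pi) ^ (2 * m) * ((-1 : ℝ) ^ (k + 1) * coeffB m k) : ℝ) : ℂ) *
    f (Real.exp (Real.pi * (k : ℝ) / σ) * x)

/-- The `k`-th term of the series `R^{(r)}(σ) f (x)`, for `r ≥ 1`: `r = 2m - 1` or `r = 2m`. -/
def rieszTerm (r : ℕ) (σ : ℝ) (f : ℝ → ℂ) (k : ℤ) (x : ℝ) : ℂ :=
  if Odd r then termOdd ((r + 1) / 2) σ f k x else termEven (r / 2) σ f k x

/-- `R^{(r)}(σ) f = g` in `X^p(ℝ₊)`: the series over `k ∈ ℤ` that defines `R^{(r)}(σ) f`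
converges in the norm of `X^p(ℝ₊)` and has the sum `g`. -/
def IsRieszBoas (p : ℝ≥0∞) (r : ℕ) (σ : ℝ) (f g : ℝ → ℂ) : Prop :=
  MemX p g ∧
    Tendsto (fun s : Finset ℤ => XNorm p (fun x => (∑ k ∈ s, rieszTerm r σ f k x) - g x))
      atTop (𝓝 0)

end MellinBernstein

end

/-!
In the variable `u = log x` the operator `Θ` is the generator of the translations of `ℝ`, and the
Bernstein space consists of the smooth `F` with `‖F⁽ᵏ⁾‖ₚ ≤ σᵏ ‖F‖ₚ`. Such `F` are bounded together
with all derivatives. For `F` of type `π` that is also integrable, the Fourier transform lives on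
`[-1/2, 1/2]`, and expanding `(iv)ʳ` on `[-π, π]` in exponentials of frequencies `k - 1/2` (`r` odd,
which makes the multiplier periodic) or `k` (`r` even) turns Fourier inversion into the Riesz–Boas
series; a bounded `F` is approximated by `F ((1 - b) u) s (b u)` with `s` integrable of type `π`,
`s 0 = 1` and `b → 0`.

Conversely, the coefficients of the series of order one have `ℓ¹`-norm exactly `σ`. Since
translations are isometries, `F' = R F` yields `‖F⁽ᵏ⁺¹⁾‖ₚ ≤ σ ‖F⁽ᵏ⁾‖ₚ`, which is membership in the
Bernstein space.
-/

noncomputable section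

namespace MellinBernstein

open scoped ENNReal NNReal ContDiff FourierTransform Interval Real
open Complex (I)

/-! ### Fourier series -/

lemma memLp_restrict_Ioc_of_continuous {E : Type*} [NormedAddCommGroup E] {f : ℝ → E}
    (hf : Continuous f) (p : ℝ≥0∞) (a b : ℝ) : MemLp f p (volume.restrict (Ioc a b)) := by
  obtain ⟨C, hC⟩ := isCompact_Icc.exists_bound_of_continuousOn (hf.continuousOn (s := Icc a b))
  exact MemLp.of_bound hf.aestronglyMeasurable C <|
    (ae_restrict_mem measurableSet_Ioc).mono fun x hx => hC x (Ioc_subset_Icc_self hx)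

lemma summable_fourierCoeffOn_of_hasDerivAt {a b : ℝ} (hab : a < b) {f f' : ℝ → ℂ}
    (hf : ∀ x, HasDerivAt f (f' x) x) (hf' : Continuous f') (h : f a = f b) :
    Summable (fourierCoeffOn hab f) := by
  have hsum : Summable fun n : ℤ =>
      ‖((b - a) / (2 * π * I) : ℂ)‖ * (‖fourierCoeffOn hab f' n‖ ^ 2 + 1 / (n : ℝ) ^ 2) :=
    ((hasSum_sq_fourierCoeffOn hab (memLp_restrict_Ioc_of_continuous hf' 2 a b)).summable.add
      (Real.summable_one_div_int_pow.2 one_lt_two)).mul_left _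
  refine hsum.of_norm_bounded_eventually ?_
  filter_upwards [(finite_singleton (0 : ℤ)).compl_mem_cofinite] with n hn
  have hparts : fourierCoeffOn hab f n =
      (b - a) / (2 * π * I) * (fourierCoeffOn hab f' n * (1 / n)) := by
    rw [fourierCoeffOn_of_hasDerivAt hab hn (fun x _ => hf x) (hf'.intervalIntegrable _ _), h]
    ring
  have amgm : ‖fourierCoeffOn hab f' n‖ * ‖(1 / n : ℂ)‖ ≤
      ‖fourierCoeffOn hab f' n‖ ^ 2 + ‖(1 / n : ℂ)‖ ^ 2 := by
    nlinarith [sq_nonneg (‖fourierCoeffOn hab f' n‖ - ‖(1 / n : ℂ)‖)]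
  have hnorm : ‖(1 / n : ℂ)‖ ^ 2 = 1 / (n : ℝ) ^ 2 := by simp
  rw [hparts, norm_mul, norm_mul, ← hnorm]
  gcongr

lemma hasSum_fourierCoeffOn {a b : ℝ} (hab : a < b) {f : ℝ → ℂ} (hf : ContinuousOn f (Icc a b))
    (h : f a = f b) (hs : Summable (fourierCoeffOn hab f)) {x : ℝ} (hx : x ∈ Icc a b) :
    HasSum (fun n : ℤ => fourierCoeffOn hab f n * fourier n (x : AddCircle (b - a))) (f x) := by
  have := Fact.mk (sub_pos.2 hab)
  have hb : a + (b - a) = b := by ring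
  let F : C(AddCircle (b - a), ℂ) := ⟨AddCircle.liftIco (b - a) a f,
    AddCircle.liftIco_continuous (by rw [hb, h]) (by rwa [hb])⟩
  have hF : F x = f x := by
    rcases hx.2.eq_or_lt with rfl | hlt
    · have hxa : ((x : ℝ) : AddCircle (x - a)) = a := by
        simpa [hb] using AddCircle.coe_add_period (x - a) a
      rw [hxa, ← h]
      exact AddCircle.liftIco_coe_apply (by rwa [hb, left_mem_Ico])
    · exact AddCircle.liftIco_coe_apply ⟨hx.1, by rwa [hb]⟩
  have hcoeff : fourierCoeff F = fourierCoeffOn hab f := by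
    ext n
    simpa only [hb] using! fourierCoeff_liftIco_eq (T := b - a) (a := a) f n
  simpa [hcoeff, hF] using
    has_pointwise_sum_fourier_series_of_summable (f := F) (by rwa [hcoeff]) x

/-! ### The cardinal sine and the coefficients of the interpolation formula -/

/-- The uniform probability measure on `[-π, π]`, whose characteristic function is the cardinal
sine. -/
def uniformMeasure : Measure ℝ :=
  ENNReal.ofReal (2 * π)⁻¹ • volume.restrict (Ioc (-π) π)

instance : IsFiniteMeasure uniformMeasure := by
  rw [uniformMeasure]
  exact (volume.restrict (Ioc (-π) π)).smul_finite ENNReal.ofReal_ne_top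

lemma integral_uniformMeasure (f : ℝ → ℂ) :
    ∫ v, f v ∂uniformMeasure = (2 * π)⁻¹ * ∫ v in -π..π, f v := by
  rw [uniformMeasure, integral_smul_measure, ENNReal.toReal_ofReal (by positivity),
    intervalIntegral.integral_of_le (by linarith [Real.pi_pos]), Complex.real_smul]

lemma memLp_id_uniformMeasure (p : ℝ≥0∞) : MemLp id p uniformMeasure :=
  (memLp_restrict_Ioc_of_continuous continuous_id p _ _).smul_measure ENNReal.ofReal_ne_top

lemma charFun_uniformMeasure (x : ℝ) : charFun uniformMeasure x = sincN x := by
  rw [charFun_apply_real, integral_uniformMeasure, sincN]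
  have hπ : (π : ℂ) ≠ 0 := mod_cast Real.pi_ne_zero
  rcases eq_or_ne x 0 with rfl | hx
  · simp [← two_mul, mul_assoc, hπ]
  · have hscale : x • ∫ v in -π..π, Complex.exp ((x * v : ℝ) * I) =
        2 * (π * x : ℝ) * Real.sinc (π * x) := by
      rw [intervalIntegral.smul_integral_comp_mul_left (fun t : ℝ => Complex.exp (t * I)), mul_neg,
        mul_comm x, integral_exp_mul_I_eq_sinc]
    have hx' : (x : ℂ) ≠ 0 := mod_cast hx
    apply mul_left_cancel₀ hx'
    rw [Complex.real_smul] at hscale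
    push_cast at hscale ⊢
    rw [mul_left_comm, hscale]
    field_simp

lemma contDiff_sincN : ContDiff ℝ ∞ sincN := by
  have : sincN = Complex.reCLM ∘ charFun uniformMeasure := by
    ext x
    simp [charFun_uniformMeasure]
  rw [this]
  exact Complex.reCLM.contDiff.comp (contDiff_charFun' fun k => memLp_id_uniformMeasure k)

lemma iteratedDeriv_clm_comp {E F : Type*} [NormedAddCommGroup E] [NormedSpace ℝ E]
    [NormedAddCommGroup F] [NormedSpace ℝ F] (L : E →L[ℝ] F) {g : ℝ → E} {n : ℕ}
    (hg : ContDiff ℝ n g) (x : ℝ) :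
    iteratedDeriv n (L ∘ g) x = L (iteratedDeriv n g x) := by
  simp [iteratedDeriv, L.iteratedFDeriv_comp_left hg.contDiffAt le_rfl]

lemma iteratedDeriv_sincN (n : ℕ) (x : ℝ) :
    ((iteratedDeriv n sincN x : ℝ) : ℂ) =
      (2 * π)⁻¹ * ∫ v in -π..π, (I * v) ^ n * Complex.exp (I * v * x) := by
  have hsinc : charFun uniformMeasure = Complex.ofRealCLM ∘ sincN := funext charFun_uniformMeasure
  have h := iteratedDeriv_charFun (t := x) (memLp_id_uniformMeasure n)
  rw [hsinc, iteratedDeriv_clm_comp _ (contDiff_sincN.of_le (mod_cast le_top)),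
    ← integral_const_mul, integral_uniformMeasure] at h
  refine h.trans ?_
  simp only [mul_pow, mul_comm, mul_left_comm]

/-- The fractional offset of the nodes `k - nodeShift r` of the formula of order `r`. -/
def nodeShift (r : ℕ) : ℝ := if Odd r then 1 / 2 else 0

/-- The `k`-th node of the formula of order `r` for functions of exponential type `π`. -/
def node (r : ℕ) (k : ℤ) : ℝ := k - nodeShift r

/-- The coefficient at `node r k` in the formula of order `r` for functions of exponential
type `π`. -/
def nodeCoeff (r : ℕ) (k : ℤ) : ℝ := iteratedDeriv r sincN (-node r k)

lemma exp_nodeShift (r : ℕ) : Complex.exp (I * π * nodeShift r) =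
    (-1) ^ r * Complex.exp (I * ((-π : ℝ) : ℂ) * nodeShift r) := by
  by_cases hr : Odd r
  · have hhalf : I * π * ((1 / 2 : ℝ) : ℂ) = π / 2 * I := by push_cast; ring
    have hhalf' : I * ((-π : ℝ) : ℂ) * ((1 / 2 : ℝ) : ℂ) = -(π / 2 * I) := by push_cast; ring
    rw [nodeShift, if_pos hr, hr.neg_one_pow, hhalf, hhalf', Complex.exp_neg,
      Complex.exp_pi_div_two_mul_I]
    simp
  · rw [nodeShift, if_neg hr, (Nat.not_odd_iff_even.1 hr).neg_one_pow]
    simp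

/-- The multiplier `(iv)^r`, modulated so that it takes the same value at `-π` and `π`; its Fourier
coefficients on `[-π, π]` are the coefficients of the formula of order `r`. -/
def modulatedPow (r : ℕ) (v : ℝ) : ℂ := (I * v) ^ r * Complex.exp (I * v * nodeShift r)

lemma contDiff_modulatedPow (r : ℕ) : ContDiff ℝ 1 (modulatedPow r) := by
  have : ContDiff ℝ 1 (fun v : ℝ => (v : ℂ)) := Complex.ofRealCLM.contDiff
  unfold modulatedPow
  fun_prop

lemma modulatedPow_neg_pi (r : ℕ) : modulatedPow r (-π) = modulatedPow r π := by
  rw [modulatedPow, modulatedPow, exp_nodeShift, Complex.ofReal_neg, mul_neg, neg_pow]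
  ring

lemma neg_pi_lt_pi : -π < π := by linarith [Real.pi_pos]

lemma fourier_coe_neg_pi_pi (k : ℤ) (v : ℝ) :
    fourier k (v : AddCircle (π - -π)) = Complex.exp (I * v * k) := by
  have hπ : (π : ℂ) ≠ 0 := mod_cast Real.pi_ne_zero
  rw [fourier_coe_apply]
  congr 1
  push_cast
  field_simp
  ring

lemma fourierCoeffOn_modulatedPow (r : ℕ) (k : ℤ) :
    fourierCoeffOn neg_pi_lt_pi (modulatedPow r) k = nodeCoeff r k := by
  rw [fourierCoeffOn_eq_integral, nodeCoeff, iteratedDeriv_sincN, Complex.real_smul]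
  congr! 2 with v
  · ring
  · ext v
    rw [smul_eq_mul, fourier_coe_neg_pi_pi, modulatedPow, mul_left_comm, ← Complex.exp_add, node]
    push_cast
    ring_nf

lemma summable_fourierCoeffOn_modulatedPow (r : ℕ) :
    Summable (fourierCoeffOn neg_pi_lt_pi (modulatedPow r)) :=
  have hψ := contDiff_modulatedPow r
  summable_fourierCoeffOn_of_hasDerivAt _
    (fun x => (hψ.differentiable one_ne_zero x).hasDerivAt) (hψ.continuous_deriv le_rfl)
    (modulatedPow_neg_pi r)

lemma summable_nodeCoeff (r : ℕ) : Summable fun k => |nodeCoeff r k| := by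
  simpa only [fourierCoeffOn_modulatedPow, Complex.norm_real, Real.norm_eq_abs] using
    (summable_fourierCoeffOn_modulatedPow r).norm

lemma hasSum_nodeCoeff_mul_exp (r : ℕ) {v : ℝ} (hv : v ∈ Icc (-π) π) :
    HasSum (fun k : ℤ => (nodeCoeff r k : ℂ) * Complex.exp (I * v * node r k)) ((I * v) ^ r) := by
  have h := (hasSum_fourierCoeffOn neg_pi_lt_pi (contDiff_modulatedPow r).continuous.continuousOn
    (modulatedPow_neg_pi r) (summable_fourierCoeffOn_modulatedPow r) hv).mul_right
    (Complex.exp (-(I * v * nodeShift r)))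
  simp only [fourierCoeffOn_modulatedPow, fourier_coe_neg_pi_pi, modulatedPow, mul_assoc,
    ← Complex.exp_add, add_neg_cancel, Complex.exp_zero, mul_one] at h
  refine h.congr_fun fun k => ?_
  rw [node]
  push_cast
  ring_nf

lemma half_sub_intCast_ne_zero (k : ℤ) : (1 / 2 - k : ℝ) ≠ 0 := by
  intro h
  have : (1 : ℤ) = 2 * k := by exact_mod_cast (by linarith : (1 : ℝ) = 2 * k)
  omega

lemma nodeCoeff_one (k : ℤ) : nodeCoeff 1 k = -(-1) ^ k / (π * (1 / 2 - k) ^ 2) := by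
  have hk := half_sub_intCast_ne_zero k
  have hπ := Real.pi_ne_zero
  have hsinc : sincN =ᶠ[𝓝 (1 / 2 - k : ℝ)] fun x => Real.sin (π * x) / (π * x) := by
    filter_upwards [isOpen_ne.mem_nhds hk] with x hx
    exact Real.sinc_of_ne_zero (mul_ne_zero hπ hx)
  have hlin : HasDerivAt (fun x : ℝ => π * x) π (1 / 2 - k : ℝ) := by
    simpa using (hasDerivAt_id (1 / 2 - k : ℝ)).const_mul π
  have hshift : π * (1 / 2 - k) = π / 2 - k * π := by ring
  have hcos : Real.cos (π * (1 / 2 - k)) = 0 := by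
    rw [hshift, Real.cos_pi_div_two_sub, Real.sin_int_mul_pi]
  have hsin : Real.sin (π * (1 / 2 - k)) = (-1) ^ k := by
    rw [hshift, Real.sin_pi_div_two_sub, Real.cos_int_mul_pi]
  have hnode : -node 1 k = 1 / 2 - k := by simp [node, nodeShift]
  rw [nodeCoeff, iteratedDeriv_one, hnode, hsinc.deriv_eq,
    (hlin.sin.fun_div hlin (mul_ne_zero hπ hk)).deriv, hcos, hsin]
  field_simp
  ring

lemma abs_nodeCoeff_one (k : ℤ) : |nodeCoeff 1 k| = -(-1) ^ k * nodeCoeff 1 k := by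
  have hsq : ((-1 : ℝ) ^ k) * (-1) ^ k = 1 := by rw [← mul_zpow]; simp
  have hden : 0 < π * (1 / 2 - k : ℝ) ^ 2 := by
    have := half_sub_intCast_ne_zero k
    positivity
  rw [nodeCoeff_one, abs_div, abs_neg, abs_neg_one_zpow, abs_of_pos hden,
    ← mul_div_assoc, neg_mul_neg, hsq]

-- At `v = π` each term of the expansion of `i v` is `i` times the modulus of its coefficient.
lemma hasSum_abs_nodeCoeff_one : HasSum (fun k => |nodeCoeff 1 k|) π := by
  have h := (hasSum_nodeCoeff_mul_exp 1 (right_mem_Icc.2 neg_pi_lt_pi.le)).mul_left (-I)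
  rw [← Complex.hasSum_ofReal]
  convert! h using 1
  · ext k
    have hexp : I * π * (node 1 k : ℝ) = k * (π * I) - π / 2 * I := by
      simp [node, nodeShift]
      ring
    rw [abs_nodeCoeff_one, hexp, Complex.exp_sub, Complex.exp_int_mul, Complex.exp_pi_mul_I,
      Complex.exp_pi_div_two_mul_I]
    push_cast
    field_simp
  · linear_combination (π : ℂ) * Complex.I_sq

/-! ### The Bernstein classes on the line -/

lemma contDiff_iteratedDeriv {F : ℝ → ℂ} (hF : ContDiff ℝ ∞ F) (k : ℕ) :
    ContDiff ℝ ∞ (iteratedDeriv k F) := by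
  rw [iteratedDeriv_eq_iterate]
  exact hF.iterate_deriv k

lemma enorm_le_eLpNorm_top {F : ℝ → ℂ} (hF : Continuous F) (u : ℝ) :
    ‖F u‖ₑ ≤ eLpNorm F ∞ volume := by
  have hclosed : IsClosed {u | ‖F u‖ₑ ≤ eLpNorm F ∞ volume} :=
    isClosed_le hF.enorm continuous_const
  have hdense : Dense {u | ‖F u‖ₑ ≤ eLpNorm F ∞ volume} :=
    Measure.dense_of_ae (by simpa using ae_le_eLpNormEssSup)
  exact hclosed.closure_subset (hdense u)

lemma eLpNorm_translate (p : ℝ≥0∞) (μ : Measure ℝ) [μ.IsAddRightInvariant] (F : ℝ → ℂ) (t : ℝ) :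
    eLpNorm (fun u => F (u + t)) p μ = eLpNorm F p μ := by
  conv_rhs => rw [← map_add_right_eq_self μ t]
  exact ((measurableEmbedding_addRight t).eLpNorm_map_measure).symm

lemma eLpNorm_comp_mul_left (p : ℝ≥0∞) (F : ℝ → ℂ) {a : ℝ≥0} (ha : a ≠ 0) :
    eLpNorm (fun u => F (a * u)) p volume = ↑(a⁻¹ ^ p.toReal⁻¹) * eLpNorm F p volume := by
  have ha' : (a : ℝ) ≠ 0 := by exact_mod_cast ha
  calc eLpNorm (fun u => F (a * u)) p volume
      = eLpNorm F p (volume.map fun u : ℝ => a * u) :=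
        ((measurableEmbedding_mulLeft₀ ha').eLpNorm_map_measure).symm
    _ = eLpNorm F p (a⁻¹ • volume) := by
        rw [Real.map_volume_mul_left ha', ← NNReal.coe_inv, abs_of_nonneg a⁻¹.coe_nonneg,
          ENNReal.ofReal_coe_nnreal]
        rfl
    _ = _ := by
        rw [eLpNorm_smul_measure_of_ne_zero' (inv_ne_zero ha), ENNReal.smul_def, smul_eq_mul]

lemma lintegral_enorm_unitInterval_le {p : ℝ≥0∞} (hp : 1 ≤ p) {F : ℝ → ℂ}
    (hF : AEStronglyMeasurable F volume) (u : ℝ) :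
    ∫⁻ v in Ioc u (u + 1), ‖F v‖ₑ ≤ eLpNorm F p volume := by
  rw [← eLpNorm_one_eq_lintegral_enorm]
  calc eLpNorm F 1 (volume.restrict (Ioc u (u + 1)))
      ≤ eLpNorm F p (volume.restrict (Ioc u (u + 1))) := by
        have : IsProbabilityMeasure (volume.restrict (Ioc u (u + 1))) := ⟨by simp⟩
        exact eLpNorm_le_eLpNorm_of_exponent_le hp hF.restrict
    _ ≤ eLpNorm F p volume := eLpNorm_restrict_le ..

lemma enorm_le_eLpNorm_add_eLpNorm_deriv {p : ℝ≥0∞} (hp : 1 ≤ p) {F : ℝ → ℂ}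
    (hF : ContDiff ℝ 1 F) (u : ℝ) :
    ‖F u‖ₑ ≤ eLpNorm F p volume + eLpNorm (deriv F) p volume := by
  have hF' : Continuous (deriv F) := hF.continuous_deriv le_rfl
  have hpt : ∀ v ∈ Ioc u (u + 1), ‖F u‖ₑ ≤ ‖F v‖ₑ + eLpNorm (deriv F) p volume := by
    intro v hv
    have hftc : F u = F v - ∫ y in u..v, deriv F y := by
      rw [intervalIntegral.integral_deriv_eq_sub (fun y _ => hF.differentiable one_ne_zero y)
        (hF'.intervalIntegrable _ _), sub_sub_cancel]
    calc ‖F u‖ₑ ≤ ‖F v‖ₑ + ‖∫ y in u..v, deriv F y‖ₑ := hftc ▸ enorm_sub_le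
      _ ≤ ‖F v‖ₑ + ∫⁻ y in Ioc u (u + 1), ‖deriv F y‖ₑ := by
        rw [intervalIntegral.integral_of_le hv.1.le]
        gcongr
        exact (enorm_integral_le_lintegral_enorm _).trans
          (lintegral_mono_set (Ioc_subset_Ioc_right hv.2))
      _ ≤ _ := by
        gcongr
        exact lintegral_enorm_unitInterval_le hp hF'.aestronglyMeasurable u
  calc ‖F u‖ₑ = ∫⁻ _ in Ioc u (u + 1), ‖F u‖ₑ := by simp
    _ ≤ ∫⁻ v in Ioc u (u + 1), (‖F v‖ₑ + eLpNorm (deriv F) p volume) :=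
        setLIntegral_mono' measurableSet_Ioc hpt
    _ = (∫⁻ v in Ioc u (u + 1), ‖F v‖ₑ) + eLpNorm (deriv F) p volume := by
        rw [lintegral_add_right _ measurable_const]
        simp
    _ ≤ _ := by
        gcongr
        exact lintegral_enorm_unitInterval_le hp hF.continuous.aestronglyMeasurable u

/-- The classical Bernstein class of type `σ` in `L^p(ℝ)`, with an explicit constant `C` in place
of the norm of `F`: smooth functions with `‖F^(k)‖_p ≤ C * σ ^ k` for all `k`. -/
structure IsBernstein (p : ℝ≥0∞) (C σ : ℝ≥0) (F : ℝ → ℂ) : Prop where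
  contDiff : ContDiff ℝ ∞ F
  eLpNorm_le (k : ℕ) : eLpNorm (iteratedDeriv k F) p volume ≤ C * σ ^ k

section bernstein

variable {p q r : ℝ≥0∞} {C M σ τ : ℝ≥0} {F G : ℝ → ℂ}

lemma IsBernstein.continuous_iteratedDeriv (hF : IsBernstein p C σ F) (k : ℕ) :
    Continuous (iteratedDeriv k F) :=
  (contDiff_iteratedDeriv hF.contDiff k).continuous

lemma IsBernstein.memLp_iteratedDeriv (hF : IsBernstein p C σ F) (k : ℕ) :
    MemLp (iteratedDeriv k F) p volume :=
  ⟨(hF.continuous_iteratedDeriv k).aestronglyMeasurable,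
    (hF.eLpNorm_le k).trans_lt (by finiteness)⟩

protected lemma IsBernstein.iteratedDeriv (hF : IsBernstein p C σ F) (n : ℕ) :
    IsBernstein p (C * σ ^ n) σ (iteratedDeriv n F) where
  contDiff := contDiff_iteratedDeriv hF.contDiff n
  eLpNorm_le k := by
    have h := hF.eLpNorm_le (n + k)
    rw [iteratedDeriv_eq_iterate, iteratedDeriv_eq_iterate, ← Function.iterate_add_apply,
      ← iteratedDeriv_eq_iterate, add_comm k n]
    simpa [pow_add, mul_assoc] using h

protected lemma IsBernstein.deriv (hF : IsBernstein p C σ F) :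
    IsBernstein p (C * σ) σ (deriv F) := by
  simpa [iteratedDeriv_one] using hF.iteratedDeriv 1

lemma isBernstein_top_iff :
    IsBernstein ∞ C σ F ↔ ContDiff ℝ ∞ F ∧ ∀ k u, ‖iteratedDeriv k F u‖ ≤ C * σ ^ k := by
  refine ⟨fun h => ⟨h.contDiff, fun k u => ?_⟩, fun h => ⟨h.1, fun k => ?_⟩⟩
  · have := (enorm_le_eLpNorm_top (h.continuous_iteratedDeriv k) u).trans (h.eLpNorm_le k)
    rw [enorm_eq_nnnorm] at this
    exact_mod_cast this
  · rw [eLpNorm_exponent_top]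
    refine eLpNormEssSup_le_of_ae_enorm_bound (ae_of_all _ fun u => ?_)
    rw [enorm_eq_nnnorm]
    exact_mod_cast h.2 k u

lemma IsBernstein.norm_le (hF : IsBernstein ∞ C σ F) (u : ℝ) : ‖F u‖ ≤ C := by
  simpa using (isBernstein_top_iff.1 hF).2 0 u

lemma IsBernstein.top (hp : 1 ≤ p) (hF : IsBernstein p C σ F) :
    IsBernstein ∞ (C * (1 + σ)) σ F where
  contDiff := hF.contDiff
  eLpNorm_le k := by
    rw [eLpNorm_exponent_top]
    refine eLpNormEssSup_le_of_ae_enorm_bound (ae_of_all _ fun u => ?_)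
    calc ‖iteratedDeriv k F u‖ₑ
        ≤ eLpNorm (iteratedDeriv k F) p volume + eLpNorm (iteratedDeriv (k + 1) F) p volume := by
          rw [iteratedDeriv_succ]
          exact enorm_le_eLpNorm_add_eLpNorm_deriv hp
            ((contDiff_iteratedDeriv hF.contDiff k).of_le (by simp)) u
      _ ≤ C * σ ^ k + C * σ ^ (k + 1) := add_le_add (hF.eLpNorm_le k) (hF.eLpNorm_le (k + 1))
      _ = ↑(C * (1 + σ)) * (σ : ℝ≥0∞) ^ k := by push_cast; ring

lemma IsBernstein.translate (hF : IsBernstein p C σ F) (t : ℝ) :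
    IsBernstein p C σ (fun u => F (u + t)) where
  contDiff := hF.contDiff.comp (contDiff_id.add contDiff_const)
  eLpNorm_le k := by
    rw [iteratedDeriv_comp_add_const]
    exact (eLpNorm_translate p volume _ t).trans_le (hF.eLpNorm_le k)

lemma IsBernstein.comp_mul_left (hF : IsBernstein p C σ F) {a : ℝ≥0} (ha : a ≠ 0) :
    IsBernstein p (a⁻¹ ^ p.toReal⁻¹ * C) (a * σ) (fun u => F (a * u)) where
  contDiff := hF.contDiff.comp (contDiff_const.mul contDiff_id)
  eLpNorm_le k := by
    have hderiv : iteratedDeriv k (fun u => F (a * u)) =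
        (a : ℝ) ^ k • fun u => iteratedDeriv k F (a * u) :=
      iteratedDeriv_comp_const_smul (hF.contDiff.of_le (by exact_mod_cast le_top)) (a : ℝ)
    calc eLpNorm (iteratedDeriv k fun u => F (a * u)) p volume
        = a ^ k * (↑(a⁻¹ ^ p.toReal⁻¹) * eLpNorm (iteratedDeriv k F) p volume) := by
          rw [hderiv, ← eLpNorm_comp_mul_left p _ ha]
          exact (eLpNorm_const_smul ((a : ℝ) ^ k) _ p volume).trans (by simp [enorm_eq_nnnorm])
      _ ≤ a ^ k * (↑(a⁻¹ ^ p.toReal⁻¹) * (C * σ ^ k)) := by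
          gcongr
          exact hF.eLpNorm_le k
      _ = _ := by
          push_cast
          ring

lemma IsBernstein.const_mul (hF : IsBernstein p C σ F) (c : ℂ) :
    IsBernstein p (‖c‖₊ * C) σ (fun u => c * F u) where
  contDiff := contDiff_const.mul hF.contDiff
  eLpNorm_le k := by
    have hderiv : iteratedDeriv k (fun u => c * F u) = c • iteratedDeriv k F :=
      funext fun u => iteratedDeriv_const_mul_field c F
    rw [hderiv, ENNReal.coe_mul, mul_assoc]
    refine (eLpNorm_const_smul c _ p volume).trans_le ?_
    rw [enorm_eq_nnnorm]
    gcongr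
    exact hF.eLpNorm_le k

lemma iteratedDeriv_succ_mul {k : ℕ} (hF : ContDiff ℝ (k + 1) F) (hG : ContDiff ℝ (k + 1) G) :
    iteratedDeriv (k + 1) (F * G) =
      iteratedDeriv k (deriv F * G) + iteratedDeriv k (F * deriv G) := by
  have hleibniz : deriv (F * G) = deriv F * G + F * deriv G := by
    ext u
    exact deriv_mul (hF.differentiable (by simp) u) (hG.differentiable (by simp) u)
  have hle : (k : ℕ∞ω) ≤ k + 1 := by exact_mod_cast k.le_succ
  rw [iteratedDeriv_succ', hleibniz]
  ext u
  exact iteratedDeriv_add (hF.deriv'.mul (hG.of_le hle)).contDiffAt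
    ((hF.of_le hle).mul hG.deriv').contDiffAt

lemma IsBernstein.mul [ENNReal.HolderTriple p q r] (hr : 1 ≤ r) (hF : IsBernstein p C σ F)
    (hG : IsBernstein q M τ G) : IsBernstein r (C * M) (σ + τ) (F * G) where
  contDiff := hF.contDiff.mul hG.contDiff
  eLpNorm_le k := by
    induction k generalizing C M F G with
    | zero =>
      simp only [iteratedDeriv_zero, pow_zero, mul_one, ENNReal.coe_mul]
      refine (eLpNorm_smul_le_mul_eLpNorm (p := p) (q := q)
        hG.contDiff.continuous.aestronglyMeasurable
        hF.contDiff.continuous.aestronglyMeasurable).trans ?_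
      gcongr
      · simpa using hF.eLpNorm_le 0
      · simpa using hG.eLpNorm_le 0
    | succ k ih =>
      have hmeas {F : ℝ → ℂ} (hF : ContDiff ℝ ∞ F) :
          AEStronglyMeasurable (iteratedDeriv k F) volume :=
        (contDiff_iteratedDeriv hF k).continuous.aestronglyMeasurable
      calc eLpNorm (iteratedDeriv (k + 1) (F * G)) r volume
          = eLpNorm (iteratedDeriv k (deriv F * G) + iteratedDeriv k (F * deriv G)) r volume := by
            rw [iteratedDeriv_succ_mul (hF.contDiff.of_le (by exact_mod_cast le_top))
              (hG.contDiff.of_le (by exact_mod_cast le_top))]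
        _ ≤ ↑(C * σ * M) * ↑(σ + τ) ^ k + ↑(C * (M * τ)) * ↑(σ + τ) ^ k :=
            (eLpNorm_add_le (hmeas (hF.deriv.contDiff.mul hG.contDiff))
              (hmeas (hF.contDiff.mul hG.deriv.contDiff)) hr).trans
              (add_le_add (ih hF.deriv hG) (ih hF hG.deriv))
        _ = ↑(C * M) * ↑(σ + τ) ^ (k + 1) := by
            push_cast
            ring

end bernstein

/-! ### The interpolation formula -/

lemma eLpNorm_two_fourier (φ : SchwartzMap ℝ ℂ) :
    eLpNorm (𝓕 (φ : ℝ → ℂ)) 2 volume = eLpNorm φ 2 volume := by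
  have h := SchwartzMap.norm_fourier_toL2_eq φ
  simp only [SchwartzMap.norm_toLp] at h
  rw [← SchwartzMap.fourier_coe]
  exact (ENNReal.toReal_eq_toReal_iff' (SchwartzMap.memLp _ 2 volume).2.ne
    (SchwartzMap.memLp _ 2 volume).2.ne).1 h

lemma norm_two_pi_I_mul (v : ℝ) : ‖(2 * π * I * v : ℂ)‖ = 2 * π * |v| := by
  simp [abs_of_pos Real.pi_pos]

lemma isBernstein_two_fourier {φ : ℝ → ℂ} (hφ : ContDiff ℝ ∞ φ) {c : ℝ≥0}
    (hsupp : ∀ v : ℝ, c < |v| → φ v = 0) :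
    IsBernstein 2 (eLpNorm φ 2 volume).toNNReal (2 * NNReal.pi * c) (𝓕 φ) := by
  have hcs : HasCompactSupport φ :=
    HasCompactSupport.intro (isCompact_closedBall (0 : ℝ) c) fun v hv => hsupp v (by simpa using hv)
  have hpow (k : ℕ) : Integrable fun v : ℝ => v ^ k • φ v :=
    ((continuous_pow k).smul hφ.continuous).integrable_of_hasCompactSupport hcs.smul_left
  refine ⟨Real.contDiff_fourier (N := ⊤) fun k _ => ?_, fun k => ?_⟩
  · simpa [norm_smul] using (hpow k).norm
  have hsmooth : ContDiff ℝ ∞ fun v : ℝ => (-2 * π * I * v) ^ k • φ v :=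
    ((contDiff_const.mul Complex.ofRealCLM.contDiff).pow k).smul hφ
  have hcs' : HasCompactSupport fun v : ℝ => (-2 * π * I * v) ^ k • φ v :=
    hcs.smul_left (f := fun v : ℝ => (-2 * π * I * v : ℂ) ^ k)
  let ψ : SchwartzMap ℝ ℂ := hcs'.toSchwartzMap hsmooth
  have hψ (v : ℝ) : ‖ψ v‖ ≤ (2 * NNReal.pi * c) ^ k * ‖φ v‖ := by
    change ‖(-2 * π * I * v) ^ k • φ v‖ ≤ _
    by_cases hv : c < |v|
    · simp [hsupp v hv]
    · rw [norm_smul, norm_pow, neg_mul, neg_mul, neg_mul, norm_neg, norm_two_pi_I_mul]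
      gcongr
      · exact le_rfl
      · exact not_lt.1 hv
  calc eLpNorm (iteratedDeriv k (𝓕 φ)) 2 volume = eLpNorm ψ 2 volume := by
        rw [Real.iteratedDeriv_fourier (N := ⊤) (fun n _ => hpow n) le_top]
        exact eLpNorm_two_fourier ψ
    _ ≤ ↑((2 * NNReal.pi * c) ^ k) * eLpNorm φ 2 volume :=
        eLpNorm_le_nnreal_smul_eLpNorm_of_ae_le_mul (ae_of_all _ hψ) 2
    _ = _ := by
        rw [ENNReal.coe_toNNReal (hφ.continuous.memLp_of_hasCompactSupport hcs).eLpNorm_ne_top,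
          mul_comm, ENNReal.coe_pow]

lemma exists_isBernstein_one_apply_zero_eq_one :
    ∃ (s : ℝ → ℂ) (M : ℝ≥0), IsBernstein 1 M NNReal.pi s ∧ s 0 = 1 := by
  let b : ContDiffBump (0 : ℝ) := ⟨1 / 8, 1 / 4, by norm_num, by norm_num⟩
  let φ : ℝ → ℂ := fun v => b v
  have hφ : IsBernstein 2 _ (2 * NNReal.pi * (1 / 4)) (𝓕 φ) :=
    isBernstein_two_fourier (Complex.ofRealCLM.contDiff.comp b.contDiff) fun v hv => by
      have : b v = 0 := b.zero_of_le_dist (by simpa [b] using hv.le)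
      simp [this]
  have hzero : 𝓕 φ 0 ≠ 0 := by
    have : 𝓕 φ 0 = ((∫ v, b v : ℝ) : ℂ) := by
      rw [Real.fourier_real_eq_integral_exp_smul, ← integral_complex_ofReal]
      simp only [mul_zero, Complex.ofReal_zero, zero_mul, Complex.exp_zero, one_smul, φ]
    exact this ▸ Complex.ofReal_ne_zero.2 b.integral_pos.ne'
  have : ENNReal.HolderTriple 2 2 1 := ENNReal.HolderConjugate.instTwoTwo
  have htype : 2 * NNReal.pi * (1 / 4) + 2 * NNReal.pi * (1 / 4) = NNReal.pi := by
    ext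
    push_cast
    ring
  have hmul := (hφ.mul le_rfl hφ).const_mul (𝓕 φ 0 * 𝓕 φ 0)⁻¹
  rw [htype] at hmul
  exact ⟨_, _, hmul, inv_mul_cancel₀ (mul_ne_zero hzero hzero)⟩

lemma fourier_eq_zero_of_isBernstein_one {C σ : ℝ≥0} {g : ℝ → ℂ} (hg : IsBernstein 1 C σ g)
    {v : ℝ} (hv : σ < 2 * π * |v|) : 𝓕 g v = 0 := by
  have hbound (k : ℕ) : ‖𝓕 g v‖ ≤ C * (σ / (2 * π * |v|)) ^ k := by
    have hfourier := congrFun (Real.fourier_iteratedDeriv (N := ⊤) hg.contDiff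
      (fun n _ => memLp_one_iff_integrable.1 (hg.memLp_iteratedDeriv n)) (n := k) le_top) v
    have hle : ‖𝓕 (iteratedDeriv k g) v‖ ≤ C * σ ^ k := by
      refine (VectorFourier.norm_fourierIntegral_le_integral_norm _ _ _ _ _).trans ?_
      rw [integral_norm_eq_lintegral_enorm (hg.memLp_iteratedDeriv k).1,
        ← eLpNorm_one_eq_lintegral_enorm]
      exact ENNReal.toReal_le_of_le_ofReal (by positivity)
        ((hg.eLpNorm_le k).trans_eq (by norm_cast; simp))
    rw [hfourier, norm_smul, norm_pow, norm_two_pi_I_mul] at hle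
    rw [div_pow, mul_div_assoc', le_div_iff₀' (pow_pos (σ.coe_nonneg.trans_lt hv) k)]
    exact hle
  have hpos : 0 < 2 * π * |v| := σ.coe_nonneg.trans_lt hv
  have hlim : Tendsto (fun k => C * (σ / (2 * π * |v|)) ^ k) atTop (𝓝 0) := by
    simpa using (tendsto_pow_atTop_nhds_zero_of_lt_one (by positivity)
      ((div_lt_one hpos).2 hv)).const_mul (C : ℝ)
  exact norm_le_zero_iff.1 (ge_of_tendsto' hlim hbound)

lemma integrable_mul_fourier_of_isBernstein_one {C σ : ℝ≥0} {g : ℝ → ℂ}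
    (hg : IsBernstein 1 C σ g) {q : ℝ → ℂ} (hq : Continuous q) :
    Integrable fun v => q v * 𝓕 g v := by
  have hint : Integrable g := memLp_one_iff_integrable.1 (hg.memLp_iteratedDeriv 0)
  have hcont : Continuous (𝓕 g) :=
    VectorFourier.fourierIntegral_continuous Real.continuous_fourierChar
      (by exact continuous_inner) hint
  have hsupp : HasCompactSupport (𝓕 g) :=
    HasCompactSupport.intro (isCompact_closedBall (0 : ℝ) (σ / (2 * π))) fun v hv =>
      fourier_eq_zero_of_isBernstein_one hg
        ((div_lt_iff₀' Real.two_pi_pos).1 (by simpa using hv))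
  exact (hq.mul hcont).integrable_of_hasCompactSupport hsupp.mul_left

lemma iteratedDeriv_eq_integral_fourier {C σ : ℝ≥0} {g : ℝ → ℂ} (hg : IsBernstein 1 C σ g)
    (k : ℕ) (u : ℝ) :
    iteratedDeriv k g u =
      ∫ v : ℝ, (I * ↑(2 * π * v)) ^ k * Complex.exp (I * ↑(2 * π * v) * u) * 𝓕 g v := by
  have hint (n : ℕ) : Integrable (iteratedDeriv n g) :=
    memLp_one_iff_integrable.1 (hg.memLp_iteratedDeriv n)
  have hfourier : 𝓕 (iteratedDeriv k g) = fun v : ℝ => (2 * π * I * v) ^ k • 𝓕 g v :=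
    Real.fourier_iteratedDeriv (N := ⊤) hg.contDiff (fun n _ => hint n) le_top
  have hinv := (hint k).fourierInv_fourier_eq
    (by simpa only [hfourier, smul_eq_mul] using
      integrable_mul_fourier_of_isBernstein_one hg (by fun_prop))
    (hg.continuous_iteratedDeriv k).continuousAt (v := u)
  rw [← hinv, Real.fourierInv_eq', hfourier]
  refine integral_congr_ae (ae_of_all _ fun v => ?_)
  have hexp : ((2 * π * inner ℝ v u : ℝ) : ℂ) * I = I * ↑(2 * π * v) * u := by
    simp
    ring
  simp only [hexp, smul_eq_mul]
  push_cast
  ring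

lemma hasSum_nodeCoeff_of_isBernstein_one {C : ℝ≥0} {g : ℝ → ℂ}
    (hg : IsBernstein 1 C NNReal.pi g) (r : ℕ) :
    HasSum (fun k => (nodeCoeff r k : ℂ) * g (node r k)) (iteratedDeriv r g 0) := by
  let term (k : ℤ) (v : ℝ) : ℂ :=
    nodeCoeff r k * (Complex.exp (I * ↑(2 * π * v) * node r k) * 𝓕 g v)
  have hterm (k : ℤ) : Integrable (term k) :=
    (integrable_mul_fourier_of_isBernstein_one hg (by fun_prop)).const_mul _
  have hnorm (k : ℤ) (v : ℝ) : ‖term k v‖ = |nodeCoeff r k| * ‖𝓕 g v‖ := by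
    have : I * ↑(2 * π * v) * node r k = ((2 * π * v * node r k : ℝ) : ℂ) * I := by
      push_cast
      ring
    simp only [term, norm_mul, this, Complex.norm_exp_ofReal_mul_I, one_mul, Complex.norm_real,
      Real.norm_eq_abs]
  have hsummable : Summable fun k => ∫ v, ‖term k v‖ := by
    simpa only [hnorm, integral_const_mul] using (summable_nodeCoeff r).mul_right _
  have hsum (v : ℝ) : ∑' k, term k v = (I * ↑(2 * π * v)) ^ r * 𝓕 g v := by
    by_cases hv : π < 2 * π * |v|
    · simp [term, fourier_eq_zero_of_isBernstein_one hg hv]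
    · have hmem : 2 * π * v ∈ Icc (-π) π := by
        rw [mem_Icc, ← abs_le, abs_mul, abs_of_pos Real.two_pi_pos]
        exact not_lt.1 hv
      simpa only [term, mul_assoc] using ((hasSum_nodeCoeff_mul_exp r hmem).mul_right _).tsum_eq
  have hint := hasSum_integral_of_summable_integral_norm hterm hsummable
  simp only [hsum] at hint
  rw [iteratedDeriv_eq_integral_fourier hg]
  convert! hint using 1
  · ext k
    rw [integral_const_mul]
    congr 1
    simpa using iteratedDeriv_eq_integral_fourier hg 0 (node r k)
  · simp

lemma iteratedDeriv_dilation_mul_dilation {H s : ℝ → ℂ} (hH : ContDiff ℝ ∞ H)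
    (hs : ContDiff ℝ ∞ s) (a b : ℝ) (r : ℕ) :
    iteratedDeriv r (fun u => H (a * u) * s (b * u)) 0 =
      ∑ i ∈ Finset.range (r + 1), r.choose i * ((a : ℂ) ^ i * iteratedDeriv i H 0) *
        ((b : ℂ) ^ (r - i) * iteratedDeriv (r - i) s 0) := by
  have hdilation {G : ℝ → ℂ} (hG : ContDiff ℝ ∞ G) (c : ℝ) (i : ℕ) :
      iteratedDeriv i (fun u => G (c * u)) 0 = (c : ℂ) ^ i * iteratedDeriv i G 0 := by
    rw [iteratedDeriv_comp_const_smul (hG.of_le (by exact_mod_cast le_top)) c]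
    simp
  have hsmooth {G : ℝ → ℂ} (hG : ContDiff ℝ ∞ G) (c : ℝ) :
      ContDiffAt ℝ r (fun u => G (c * u)) 0 :=
    ((hG.comp (contDiff_const.mul contDiff_id)).of_le (by exact_mod_cast le_top)).contDiffAt
  rw [iteratedDeriv_fun_mul (hsmooth hH a) (hsmooth hs b)]
  simp only [hdilation hH, hdilation hs]

lemma hasSum_nodeCoeff_dilation_mul_dilation {C M : ℝ≥0} {H s : ℝ → ℂ}
    (hH : IsBernstein ∞ C NNReal.pi H) (hs : IsBernstein 1 M NNReal.pi s) {b : ℝ}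
    (hb : b ∈ Ioo 0 1) (r : ℕ) :
    HasSum (fun k => (nodeCoeff r k : ℂ) * (H ((1 - b) * node r k) * s (b * node r k)))
      (iteratedDeriv r (fun u => H ((1 - b) * u) * s (b * u)) 0) := by
  obtain ⟨a, ha⟩ : ∃ a : ℝ≥0, (a : ℝ) = 1 - b := ⟨⟨1 - b, by linarith [hb.2]⟩, rfl⟩
  lift b to ℝ≥0 using hb.1.le
  have ha0 : a ≠ 0 := NNReal.coe_ne_zero.1 (ha ▸ (sub_pos.2 hb.2).ne')
  have hb0 : b ≠ 0 := NNReal.coe_ne_zero.1 hb.1.ne'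
  have htype : a * NNReal.pi + b * NNReal.pi = NNReal.pi := by
    ext
    push_cast [ha]
    ring
  have hmul := (hH.comp_mul_left ha0).mul (r := 1) le_rfl (hs.comp_mul_left hb0)
  rw [htype] at hmul
  simpa only [ha, Pi.mul_def] using hasSum_nodeCoeff_of_isBernstein_one hmul r

lemma hasSum_nodeCoeff_of_isBernstein_top {C : ℝ≥0} {H : ℝ → ℂ}
    (hH : IsBernstein ∞ C NNReal.pi H) (r : ℕ) :
    HasSum (fun k => (nodeCoeff r k : ℂ) * H (node r k)) (iteratedDeriv r H 0) := by
  obtain ⟨s, M, hs, hs0⟩ := exists_isBernstein_one_apply_zero_eq_one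
  have hsb := hs.top le_rfl
  set B := M * (1 + NNReal.pi)
  let approx (b u : ℝ) : ℂ := H ((1 - b) * u) * s (b * u)
  have happrox (u : ℝ) : Tendsto (fun b => approx b u) (𝓝[>] 0) (𝓝 (H u)) := by
    have hcont : Continuous fun b => approx b u :=
      (hH.contDiff.continuous.comp (by fun_prop)).mul (hs.contDiff.continuous.comp (by fun_prop))
    simpa [approx, hs0] using (hcont.tendsto 0).mono_left nhdsWithin_le_nhds
  have hderiv : Tendsto (fun b => iteratedDeriv r (approx b) 0) (𝓝[>] 0)
      (𝓝 (iteratedDeriv r H 0)) := by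
    have hcont : Continuous fun b => iteratedDeriv r (approx b) 0 := by
      simp only [approx, iteratedDeriv_dilation_mul_dilation hH.contDiff hs.contDiff]
      fun_prop
    simpa [approx, hs0] using (hcont.tendsto 0).mono_left nhdsWithin_le_nhds
  have hseries : Tendsto (fun b => ∑' k, (nodeCoeff r k : ℂ) * approx b (node r k)) (𝓝[>] 0)
      (𝓝 (∑' k, (nodeCoeff r k : ℂ) * H (node r k))) := by
    refine tendsto_tsum_of_dominated_convergence ((summable_nodeCoeff r).mul_right (C * B : ℝ))
      (fun k => (happrox _).const_mul _) (Eventually.of_forall fun b k => ?_)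
    rw [norm_mul, norm_mul, Complex.norm_real, Real.norm_eq_abs]
    gcongr
    exacts [hH.norm_le _, hsb.norm_le _]
  have hsummable : Summable fun k => (nodeCoeff r k : ℂ) * H (node r k) := by
    refine .of_norm_bounded ((summable_nodeCoeff r).mul_right (C : ℝ)) fun k => ?_
    rw [norm_mul, Complex.norm_real, Real.norm_eq_abs]
    gcongr
    exact hH.norm_le _
  refine (hsummable.hasSum_iff).2 (tendsto_nhds_unique hseries (hderiv.congr' ?_))
  filter_upwards [Ioo_mem_nhdsGT (zero_lt_one' ℝ)] with b hb
  exact (hasSum_nodeCoeff_dilation_mul_dilation hH hs hb r).tsum_eq.symm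

/-- The coefficients of the interpolation formula of order `r` for functions of type `σ`. -/
def rbCoeff (σ : ℝ) (r : ℕ) (k : ℤ) : ℝ := (σ / π) ^ r * nodeCoeff r k

/-- The translations of the interpolation formula of order `r` for functions of type `σ`. -/
def rbNode (σ : ℝ) (r : ℕ) (k : ℤ) : ℝ := π / σ * node r k

lemma summable_abs_rbCoeff (σ : ℝ) (r : ℕ) : Summable fun k => |rbCoeff σ r k| := by
  simp only [rbCoeff, abs_mul]
  exact (summable_nodeCoeff r).mul_left _

lemma hasSum_abs_rbCoeff_one (σ : ℝ) : HasSum (fun k => |rbCoeff σ 1 k|) |σ| := by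
  simpa [rbCoeff, abs_mul, abs_div, abs_of_pos Real.pi_pos, Real.pi_ne_zero] using
    hasSum_abs_nodeCoeff_one.mul_left |σ / π|

lemma hasSum_rbCoeff {C σ : ℝ≥0} {F : ℝ → ℂ} (hF : IsBernstein ∞ C σ F) (hσ : σ ≠ 0) (r : ℕ)
    (u : ℝ) :
    HasSum (fun k => (rbCoeff σ r k : ℂ) * F (u + rbNode σ r k)) (iteratedDeriv r F u) := by
  have hσ' : (σ : ℝ) ≠ 0 := by exact_mod_cast hσ
  have htranslate := hF.translate u
  have hscaled := htranslate.comp_mul_left (a := NNReal.pi / σ) (by simp [hσ, NNReal.pi_ne_zero])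
  rw [div_mul_cancel₀ _ hσ] at hscaled
  have hsum := (hasSum_nodeCoeff_of_isBernstein_top hscaled r).mul_left (((σ / π) ^ r : ℝ) : ℂ)
  have hderiv : iteratedDeriv r (fun z => F (↑(NNReal.pi / σ) * z + u)) 0 =
      ((π / σ) ^ r : ℝ) • iteratedDeriv r F u := by
    rw [iteratedDeriv_comp_const_smul (f := fun z => F (z + u))
      (htranslate.contDiff.of_le (by exact_mod_cast le_top)) ((NNReal.pi / σ : ℝ≥0) : ℝ),
      iteratedDeriv_comp_add_const]
    simp
  have hcancel : (((σ / π) ^ r : ℝ) : ℂ) * (((π / σ) ^ r : ℝ) • iteratedDeriv r F u) =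
      iteratedDeriv r F u := by
    rw [Complex.real_smul, ← mul_assoc, ← Complex.ofReal_mul, ← mul_pow,
      div_mul_div_cancel₀ Real.pi_ne_zero, div_self hσ', one_pow, Complex.ofReal_one, one_mul]
  rw [hderiv, hcancel] at hsum
  refine hsum.congr_fun fun k => ?_
  simp only [rbCoeff, rbNode, NNReal.coe_div, NNReal.coe_real_pi, add_comm u]
  push_cast
  ring

/-! ### The norm of `X^p` in the logarithmic variable -/

/-- The measure on `ℝ` whose `L^p`-norm is the norm of `X^p(ℝ₊)` after the substitution
`x = exp u`: Lebesgue measure if `p < ∞`, and the counting measure if `p = ∞`, because the norm of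
`X^∞(ℝ₊)` is a supremum rather than an essential supremum. -/
def logMeasure (p : ℝ≥0∞) : Measure ℝ := if p = ⊤ then Measure.count else volume

lemma logMeasure_top : logMeasure ∞ = Measure.count := if_pos rfl

lemma logMeasure_of_ne_top {p : ℝ≥0∞} (hp : p ≠ ⊤) : logMeasure p = volume := if_neg hp

instance (p : ℝ≥0∞) : (logMeasure p).IsAddRightInvariant := by
  rcases eq_or_ne p ∞ with rfl | hp
  · rw [logMeasure_top]
    infer_instance
  · rw [logMeasure_of_ne_top hp]
    infer_instance

section logMeasure

variable {p : ℝ≥0∞} {F G H : ℝ → ℂ}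

lemma volume_absolutelyContinuous_logMeasure (p : ℝ≥0∞) : volume ≪ logMeasure p := by
  rcases eq_or_ne p ∞ with rfl | hp
  · rw [logMeasure_top]
    refine Measure.AbsolutelyContinuous.mk fun s _ hs => ?_
    rw [Measure.count_eq_zero_iff.1 hs, measure_empty]
  · rw [logMeasure_of_ne_top hp]

lemma ae_volume_of_ae_logMeasure (h : G =ᵐ[logMeasure p] H) : G =ᵐ[volume] H :=
  (volume_absolutelyContinuous_logMeasure p).ae_eq h

lemma ae_eq_logMeasure_top_iff : G =ᵐ[logMeasure ∞] H ↔ G = H := by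
  rw [logMeasure_top, EventuallyEq, Measure.ae_count_iff, funext_iff]

lemma eLpNorm_logMeasure_top (G : ℝ → ℂ) : eLpNorm G ∞ (logMeasure ∞) = ⨆ u, ‖G u‖ₑ := by
  rw [logMeasure_top, eLpNorm_exponent_top, eLpNormEssSup_count]

lemma eLpNorm_volume_le_eLpNorm_logMeasure (p : ℝ≥0∞) (G : ℝ → ℂ) :
    eLpNorm G p volume ≤ eLpNorm G p (logMeasure p) := by
  rcases eq_or_ne p ∞ with rfl | hp
  · exact eLpNormEssSup_mono_measure G (volume_absolutelyContinuous_logMeasure ∞)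
  · rw [logMeasure_of_ne_top hp]

lemma eLpNorm_logMeasure_of_continuous (p : ℝ≥0∞) (hF : Continuous F) :
    eLpNorm F p (logMeasure p) = eLpNorm F p volume := by
  rcases eq_or_ne p ∞ with rfl | hp
  · refine le_antisymm ?_ (eLpNorm_volume_le_eLpNorm_logMeasure ∞ F)
    rw [eLpNorm_logMeasure_top]
    exact iSup_le (enorm_le_eLpNorm_top hF)
  · rw [logMeasure_of_ne_top hp]

lemma eq_of_ae_eq_logMeasure (h : F =ᵐ[logMeasure p] G) (hF : Continuous F) (hG : Continuous G) :
    F = G :=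
  (hF.ae_eq_iff_eq volume hG).1 (ae_volume_of_ae_logMeasure h)

lemma ae_eq_logMeasure_translate (h : F =ᵐ[logMeasure p] G) (t : ℝ) :
    (fun u => F (u + t)) =ᵐ[logMeasure p] fun u => G (u + t) :=
  (measurePreserving_add_right (logMeasure p) t).quasiMeasurePreserving.ae_eq_comp h

lemma aestronglyMeasurable_translate (hG : AEStronglyMeasurable G volume) (t : ℝ) :
    AEStronglyMeasurable (fun u => G (u + t)) volume :=
  hG.comp_measurePreserving (measurePreserving_add_right volume t)

lemma eLpNorm_logMeasure_add_le (hp : 1 ≤ p) (hG : AEStronglyMeasurable G volume)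
    (hH : AEStronglyMeasurable H volume) :
    eLpNorm (G + H) p (logMeasure p) ≤
      eLpNorm G p (logMeasure p) + eLpNorm H p (logMeasure p) := by
  rcases eq_or_ne p ∞ with rfl | hp'
  · exact eLpNormEssSup_add_le
  · rw [logMeasure_of_ne_top hp']
    exact eLpNorm_add_le hG hH hp

lemma eLpNorm_logMeasure_sub_eq_zero_iff (hp : p ≠ 0) (hG : AEStronglyMeasurable G volume)
    (hH : AEStronglyMeasurable H volume) :
    eLpNorm (G - H) p (logMeasure p) = 0 ↔ G =ᵐ[logMeasure p] H := by
  rw [← sub_ae_eq_zero]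
  rcases eq_or_ne p ∞ with rfl | hp'
  · exact eLpNormEssSup_eq_zero_iff
  · rw [logMeasure_of_ne_top hp']
    exact eLpNorm_eq_zero_iff (hG.sub hH) hp

lemma ae_eq_logMeasure_of_tendsto {ι : Type*} {l : Filter ι} [l.NeBot] {S : ι → ℝ → ℂ}
    (hp : 1 ≤ p) (hS : ∀ i, AEStronglyMeasurable (S i) volume)
    (hG : AEStronglyMeasurable G volume) (hH : AEStronglyMeasurable H volume)
    (hSG : Tendsto (fun i => eLpNorm (S i - G) p (logMeasure p)) l (𝓝 0))
    (hSH : Tendsto (fun i => eLpNorm (S i - H) p (logMeasure p)) l (𝓝 0)) :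
    G =ᵐ[logMeasure p] H := by
  rw [← eLpNorm_logMeasure_sub_eq_zero_iff (one_pos.trans_le hp).ne' hG hH, ← nonpos_iff_eq_zero]
  refine ge_of_tendsto' (by simpa using hSG.add hSH) fun i => ?_
  rw [eLpNorm_sub_comm (S i) G, ← sub_add_sub_cancel G (S i) H]
  exact eLpNorm_logMeasure_add_le hp (hG.sub (hS i)) ((hS i).sub hH)

end logMeasure

/-! ### The generator of the group of translations -/

/-- The space `X^p(ℝ₊)` in the logarithmic variable. -/
def MemL (p : ℝ≥0∞) (G : ℝ → ℂ) : Prop :=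
  AEStronglyMeasurable G volume ∧ eLpNorm G p (logMeasure p) < ⊤

/-- `H` is the derivative of `G` in norm: the generator of the group of translations maps `G`
to `H`. This is `Θ` in the logarithmic variable. -/
def IsGen (p : ℝ≥0∞) (G H : ℝ → ℂ) : Prop :=
  MemL p G ∧ MemL p H ∧ Tendsto
    (fun t : ℝ => eLpNorm (fun u => (G (u + t) - G u) / t - H u) p (logMeasure p)) (𝓝[≠] 0) (𝓝 0)

/-- The `k`-th power of the generator of the group of translations maps `G` to `H`. -/
def IsGenPow (p : ℝ≥0∞) : ℕ → (ℝ → ℂ) → (ℝ → ℂ) → Prop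
  | 0, G, H => MemL p G ∧ MemL p H ∧ G =ᵐ[logMeasure p] H
  | k + 1, G, H => ∃ K : ℝ → ℂ, IsGenPow p k G K ∧ IsGen p K H

section generator

variable {p : ℝ≥0∞} {G G' H H' K : ℝ → ℂ}

lemma tendsto_intervalIntegral_of_tendsto_eLpNorm {ι : Type*} {l : Filter ι} {S : ι → ℝ → ℂ}
    (hp : 1 ≤ p) (hS : ∀ i, AEStronglyMeasurable (S i) volume)
    (h : Tendsto (fun i => eLpNorm (S i) p volume) l (𝓝 0)) (a b : ℝ) :
    Tendsto (fun i => ∫ u in a..b, S i u) l (𝓝 0) := by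
  have hexp : 0 ≤ 1 / (1 : ℝ≥0∞).toReal - 1 / p.toReal := by
    rcases eq_or_ne p ∞ with rfl | hp'
    · simp
    · have := ENNReal.toReal_mono hp' hp
      simp_all [inv_le_one_of_one_le₀]
  have hfin : volume (Ι a b) ^ (1 / (1 : ℝ≥0∞).toReal - 1 / p.toReal) ≠ ⊤ :=
    ENNReal.rpow_ne_top_of_nonneg hexp (by simp)
  have hlim := ENNReal.Tendsto.mul_const h (Or.inr hfin)
  rw [zero_mul] at hlim
  rw [tendsto_zero_iff_enorm_tendsto_zero]
  refine tendsto_of_tendsto_of_tendsto_of_le_of_le tendsto_const_nhds hlim (fun _ => zero_le)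
    fun i => ?_
  calc ‖∫ u in a..b, S i u‖ₑ
      ≤ ∫⁻ u in Ι a b, ‖S i u‖ₑ := by
        rw [← ofReal_norm, intervalIntegral.norm_integral_eq_norm_integral_uIoc, ofReal_norm]
        exact enorm_integral_le_lintegral_enorm _
    _ = eLpNorm (S i) 1 (volume.restrict (Ι a b)) := eLpNorm_one_eq_lintegral_enorm.symm
    _ ≤ eLpNorm (S i) p (volume.restrict (Ι a b)) * _ :=
        eLpNorm_le_eLpNorm_mul_rpow_measure_univ hp (hS i).restrict
    _ ≤ eLpNorm (S i) p volume * volume (Ι a b) ^ (1 / (1 : ℝ≥0∞).toReal - 1 / p.toReal) := by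
        rw [Measure.restrict_apply_univ]
        gcongr
        exact Measure.restrict_le_self

lemma MemL.locallyIntegrable (hp : 1 ≤ p) (hG : MemL p G) : LocallyIntegrable G volume :=
  MemLp.locallyIntegrable ⟨hG.1, (eLpNorm_volume_le_eLpNorm_logMeasure p G).trans_lt hG.2⟩ hp

lemma MemL.intervalIntegrable (hp : 1 ≤ p) (hG : MemL p G) (a b : ℝ) :
    IntervalIntegrable G volume a b :=
  intervalIntegrable_iff.mpr
    (((hG.locallyIntegrable hp).integrableOn_isCompact isCompact_uIcc).mono_set uIoc_subset_uIcc)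

lemma MemL.aestronglyMeasurable_slope (hG : MemL p G) (t : ℝ) :
    AEStronglyMeasurable (fun u => (G (u + t) - G u) / (t : ℂ)) volume :=
  ((aestronglyMeasurable_translate hG.1 t).sub hG.1).mul_const _

lemma IsGen.tendsto_integral (hp : 1 ≤ p) (h : IsGen p G H) (a b : ℝ) :
    Tendsto (fun t : ℝ => ∫ u in a..b, ((G (u + t) - G u) / (t : ℂ) - H u)) (𝓝[≠] 0) (𝓝 0) :=
  tendsto_intervalIntegral_of_tendsto_eLpNorm hp
    (fun t => (h.1.aestronglyMeasurable_slope t).sub h.2.1.1)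
    (tendsto_of_tendsto_of_tendsto_of_le_of_le tendsto_const_nhds h.2.2 (fun _ => zero_le)
      fun _ => eLpNorm_volume_le_eLpNorm_logMeasure p _) a b

lemma integral_slope (hG : ∀ c d, IntervalIntegrable G volume c d) (a b t : ℝ) :
    ∫ u in a..b, (G (u + t) - G u) / (t : ℂ) =
      t⁻¹ • ((∫ y in 0..b + t, G y) - ∫ y in 0..b, G y) -
        t⁻¹ • ((∫ y in 0..a + t, G y) - ∫ y in 0..a, G y) := by
  have hGt : IntervalIntegrable (fun u => G (u + t)) volume a b := by
    simpa using (hG (a + t) (b + t)).comp_add_right t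
  rw [intervalIntegral.integral_div, intervalIntegral.integral_sub hGt (hG a b),
    intervalIntegral.integral_comp_add_right G t,
    ← intervalIntegral.integral_interval_sub_left (hG 0 (b + t)) (hG 0 (a + t)),
    ← intervalIntegral.integral_interval_sub_left (hG 0 b) (hG 0 a)]
  simp only [Complex.real_smul, Complex.ofReal_inv]
  ring

lemma IsGen.ae_eq_volume_integral (hp : 1 ≤ p) (h : IsGen p G H) :
    ∃ c, G =ᵐ[volume] fun u => c + ∫ y in (0 : ℝ)..u, H y := by
  have hG (c d : ℝ) := h.1.intervalIntegrable hp c d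
  have hH (c d : ℝ) := h.2.1.intervalIntegrable hp c d
  have hlebesgue := LocallyIntegrable.ae_hasDerivAt_integral (h.1.locallyIntegrable hp)
  obtain ⟨a, ha⟩ := hlebesgue.exists
  refine ⟨G a - ∫ y in (0 : ℝ)..a, H y, hlebesgue.mono fun b hb => ?_⟩
  have hincrement : G b - G a = ∫ y in a..b, H y := by
    refine tendsto_nhds_unique ((hb 0).tendsto_slope_zero.sub (ha 0).tendsto_slope_zero) ?_
    have hlim := (h.tendsto_integral hp a b).add_const (∫ y in a..b, H y)
    rw [zero_add] at hlim
    refine hlim.congr fun t => ?_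
    have hslope : IntervalIntegrable (fun u => (G (u + t) - G u) / (t : ℂ)) volume a b := by
      have := (hG (a + t) (b + t)).comp_add_right t
      simp only [add_sub_cancel_right] at this
      exact (this.sub (hG a b)).div_const _
    rw [intervalIntegral.integral_sub hslope (hH a b), sub_add_cancel, integral_slope hG]
  rw [← intervalIntegral.integral_interval_sub_left (hH 0 b) (hH 0 a)] at hincrement
  linear_combination hincrement

lemma IsGen.hasDerivAt (h : IsGen ∞ G H) (u : ℝ) : HasDerivAt G (H u) u := by
  rw [hasDerivAt_iff_tendsto_slope_zero, tendsto_iff_norm_sub_tendsto_zero,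
    ← tendsto_zero_iff_norm_tendsto_zero, tendsto_zero_iff_enorm_tendsto_zero]
  refine tendsto_of_tendsto_of_tendsto_of_le_of_le tendsto_const_nhds h.2.2 (fun _ => zero_le)
    fun t => ?_
  simp only [eLpNorm_logMeasure_top, Complex.real_smul, Complex.ofReal_inv, ← div_eq_inv_mul]
  exact le_iSup (fun u => ‖(G (u + t) - G u) / (t : ℂ) - H u‖ₑ) u

lemma IsGen.ae_eq_integral (hp : 1 ≤ p) (h : IsGen p G H) :
    ∃ c, G =ᵐ[logMeasure p] fun u => c + ∫ y in (0 : ℝ)..u, H y := by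
  obtain ⟨c, hc⟩ := h.ae_eq_volume_integral hp
  refine ⟨c, ?_⟩
  rcases eq_or_ne p ∞ with rfl | hp'
  · have hG : Continuous G := continuous_iff_continuousAt.2 fun u => (h.hasDerivAt u).continuousAt
    have hI : Continuous fun u => c + ∫ y in (0 : ℝ)..u, H y :=
      continuous_const.add (intervalIntegral.continuous_primitive (h.2.1.intervalIntegrable hp) 0)
    exact ae_eq_logMeasure_top_iff.2 ((hG.ae_eq_iff_eq volume hI).1 hc)
  · rwa [logMeasure_of_ne_top hp']

lemma IsGen.congr_left (h : IsGen p G H) (hG' : AEStronglyMeasurable G' volume)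
    (hGG' : G =ᵐ[logMeasure p] G') : IsGen p G' H := by
  refine ⟨⟨hG', (eLpNorm_congr_ae hGG').symm.trans_lt h.1.2⟩, h.2.1, h.2.2.congr fun t => ?_⟩
  refine eLpNorm_congr_ae ?_
  filter_upwards [hGG', ae_eq_logMeasure_translate hGG' t] with u h₀ h₁
  rw [h₀, h₁]

lemma IsGen.unique (hp : 1 ≤ p) (h : IsGen p G H) (h' : IsGen p G H') :
    H =ᵐ[logMeasure p] H' :=
  ae_eq_logMeasure_of_tendsto hp h.1.aestronglyMeasurable_slope h.2.1.1 h'.2.1.1 h.2.2 h'.2.2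

lemma IsGenPow.unique (hp : 1 ≤ p) {k : ℕ} (h : IsGenPow p k G H) (h' : IsGenPow p k G H') :
    H =ᵐ[logMeasure p] H' := by
  induction k generalizing H H' with
  | zero => exact h.2.2.symm.trans h'.2.2
  | succ k ih =>
    obtain ⟨K, hK, hKH⟩ := h
    obtain ⟨K', hK', hKH'⟩ := h'
    exact (hKH.congr_left hKH'.1.1 (ih hK hK')).unique hp hKH'

lemma IsGenPow.exists_contDiff (hp : 1 ≤ p) {k : ℕ} (h : IsGenPow p k G H) (hK : Continuous K)
    (hHK : H =ᵐ[logMeasure p] K) :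
    ∃ F, ContDiff ℝ k F ∧ G =ᵐ[logMeasure p] F ∧ iteratedDeriv k F = K := by
  induction k generalizing H K with
  | zero => exact ⟨K, by simpa using hK, h.2.2.trans hHK, iteratedDeriv_zero⟩
  | succ k ih =>
    obtain ⟨H₁, h₁, h₂⟩ := h
    obtain ⟨c, hc⟩ := h₂.ae_eq_integral hp
    have hintegral (u : ℝ) : ∫ y in (0 : ℝ)..u, H y = ∫ y in (0 : ℝ)..u, K y :=
      intervalIntegral.integral_congr_ae
        ((ae_volume_of_ae_logMeasure hHK).mono fun y hy _ => hy)
    simp only [hintegral] at hc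
    have hderiv (u : ℝ) : HasDerivAt (fun u => c + ∫ y in (0 : ℝ)..u, K y) (K u) u :=
      (hK.integral_hasStrictDerivAt 0 u).hasDerivAt.const_add c
    obtain ⟨F, hF, hGF, hFk⟩ := ih h₁
      (continuous_iff_continuousAt.2 fun u => (hderiv u).continuousAt) hc
    have hFK : iteratedDeriv (k + 1) F = K := by
      ext u
      rw [iteratedDeriv_succ, hFk, (hderiv u).deriv]
    refine ⟨F, ?_, hGF, hFK⟩
    refine contDiff_nat_succ_iff_contDiff_one_iteratedDeriv.2 ⟨hF, ?_⟩
    rw [hFk, contDiff_one_iff_deriv, funext fun u => (hderiv u).deriv]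
    exact ⟨fun u => (hderiv u).differentiableAt, hK⟩

lemma exists_smooth_representative (hp : 1 ≤ p) (h : ∀ k, ∃ H, IsGenPow p k G H) :
    ∃ F, ContDiff ℝ ∞ F ∧ G =ᵐ[logMeasure p] F ∧
      ∀ k H, IsGenPow p k G H → H =ᵐ[logMeasure p] iteratedDeriv k F := by
  have hfinite (k : ℕ) : ∃ F H, ContDiff ℝ k F ∧ G =ᵐ[logMeasure p] F ∧ IsGenPow p k G H ∧
      H =ᵐ[logMeasure p] iteratedDeriv k F := by
    obtain ⟨H', H, hGH, hHH'⟩ := h (k + 1)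
    obtain ⟨c, hc⟩ := hHH'.ae_eq_integral hp
    have hI : Continuous fun u => c + ∫ y in (0 : ℝ)..u, H' y :=
      continuous_const.add
        (intervalIntegral.continuous_primitive (hHH'.2.1.intervalIntegrable hp) 0)
    obtain ⟨F, hF, hGF, hFk⟩ := hGH.exists_contDiff hp hI hc
    exact ⟨F, H, hF, hGF, hGH, hFk ▸ hc⟩
  choose F H hF hGF hGH hHF using hfinite
  have hFF (k : ℕ) : F k = F 0 :=
    eq_of_ae_eq_logMeasure ((hGF k).symm.trans (hGF 0)) (hF k).continuous (hF 0).continuous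
  refine ⟨F 0, contDiff_infty.2 fun k => hFF k ▸ hF k, hGF 0, fun k K hK => ?_⟩
  rw [← hFF k]
  exact (hK.unique hp (hGH k)).trans (hHF k)

end generator

section derivative

variable {p : ℝ≥0∞} {F H : ℝ → ℂ}

lemma eLpNorm_lintegral_translate_le (hp : 1 ≤ p) (hH : Continuous H) (t : ℝ) :
    eLpNorm (fun u => ∫⁻ s in Ioc (0 : ℝ) 1, ‖H (u + t * s)‖ₑ) p volume ≤ eLpNorm H p volume := by
  have : IsProbabilityMeasure (volume.restrict (Ioc (0 : ℝ) 1)) := ⟨by simp⟩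
  rcases eq_or_ne p ∞ with rfl | hp'
  · refine eLpNormEssSup_le_of_ae_enorm_bound (ae_of_all _ fun u => ?_)
    calc ∫⁻ s in Ioc (0 : ℝ) 1, ‖H (u + t * s)‖ₑ
        ≤ ∫⁻ _ in Ioc (0 : ℝ) 1, eLpNorm H ∞ volume :=
          lintegral_mono fun s => enorm_le_eLpNorm_top hH _
      _ = eLpNorm H ∞ volume := by simp
  · have hp₀ : p ≠ 0 := (one_pos.trans_le hp).ne'
    have hpos : 0 < p.toReal := ENNReal.toReal_pos hp₀ hp'
    have hjensen (u : ℝ) : (∫⁻ s in Ioc (0 : ℝ) 1, ‖H (u + t * s)‖ₑ) ^ p.toReal ≤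
        ∫⁻ s in Ioc (0 : ℝ) 1, ‖H (u + t * s)‖ₑ ^ p.toReal := by
      have hcont : Continuous fun s => H (u + t * s) := by fun_prop
      have := eLpNorm_le_eLpNorm_of_exponent_le (μ := volume.restrict (Ioc (0 : ℝ) 1)) hp
        hcont.aestronglyMeasurable
      rwa [eLpNorm_one_eq_lintegral_enorm, eLpNorm_eq_lintegral_rpow_enorm_toReal hp₀ hp',
        one_div, ENNReal.le_rpow_inv_iff hpos] at this
    rw [← ENNReal.rpow_le_rpow_iff hpos, eLpNorm_eq_lintegral_rpow_enorm_toReal hp₀ hp',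
      eLpNorm_eq_lintegral_rpow_enorm_toReal hp₀ hp', ← ENNReal.rpow_mul, ← ENNReal.rpow_mul,
      one_div_mul_cancel hpos.ne', ENNReal.rpow_one, ENNReal.rpow_one]
    calc ∫⁻ u, ‖∫⁻ s in Ioc (0 : ℝ) 1, ‖H (u + t * s)‖ₑ‖ₑ ^ p.toReal
        ≤ ∫⁻ u, ∫⁻ s in Ioc (0 : ℝ) 1, ‖H (u + t * s)‖ₑ ^ p.toReal := lintegral_mono hjensen
      _ = ∫⁻ s in Ioc (0 : ℝ) 1, ∫⁻ u, ‖H (u + t * s)‖ₑ ^ p.toReal :=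
          lintegral_lintegral_swap (by fun_prop)
      _ = ∫⁻ _ in Ioc (0 : ℝ) 1, ∫⁻ u, ‖H u‖ₑ ^ p.toReal :=
          lintegral_congr fun s => lintegral_add_right_eq_self (fun u => ‖H u‖ₑ ^ p.toReal) (t * s)
      _ = ∫⁻ u, ‖H u‖ₑ ^ p.toReal := by simp

lemma slope_sub_deriv_eq_integral (hF : ContDiff ℝ 2 F) (u : ℝ) {t : ℝ} (ht : t ≠ 0) :
    (F (u + t) - F u) / t - deriv F u =
      t * ∫ s in (0 : ℝ)..1, (1 - s) * deriv (deriv F) (u + t * s) := by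
  have hF₁ : ContDiff ℝ 1 (deriv F) := hF.deriv'
  have : Continuous (deriv (deriv F)) := hF₁.continuous_deriv le_rfl
  have hline (s : ℝ) : HasDerivAt (fun s => u + t * s) t s := by
    simpa using ((hasDerivAt_id s).const_mul t).const_add u
  have hderiv (s : ℝ) : HasDerivAt (fun s => (1 - s) * (t * deriv F (u + t * s)) + F (u + t * s))
      (t ^ 2 * ((1 - s) * deriv (deriv F) (u + t * s))) s := by
    have h₀ := (hF.differentiable two_ne_zero _).hasDerivAt.scomp s (hline s)
    have h₁ := (hF₁.differentiable one_ne_zero _).hasDerivAt.scomp s (hline s)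
    have hs : HasDerivAt (fun s : ℝ => 1 - (s : ℂ)) (-1) s :=
      Complex.ofRealCLM.hasDerivAt.const_sub 1
    refine ((hs.mul (h₁.const_mul (t : ℂ))).add h₀).congr_deriv ?_
    simp only [Complex.real_smul, Function.comp_apply]
    ring
  have hftc := intervalIntegral.integral_eq_sub_of_hasDerivAt (fun s _ => hderiv s)
    (Continuous.intervalIntegrable (by fun_prop) 0 1)
  rw [intervalIntegral.integral_const_mul] at hftc
  have ht' : (t : ℂ) ≠ 0 := by exact_mod_cast ht
  field_simp
  rw [hftc]
  simp
  ring

lemma enorm_slope_sub_deriv_le (hF : ContDiff ℝ 2 F) (u : ℝ) {t : ℝ} (ht : t ≠ 0) :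
    ‖(F (u + t) - F u) / t - deriv F u‖ₑ ≤
      ‖t‖ₑ * ∫⁻ s in Ioc (0 : ℝ) 1, ‖deriv (deriv F) (u + t * s)‖ₑ := by
  rw [slope_sub_deriv_eq_integral hF u ht, intervalIntegral.integral_of_le zero_le_one, enorm_mul]
  have : ‖(t : ℂ)‖ₑ = ‖t‖ₑ := by simp [enorm_eq_nnnorm]
  rw [this]
  gcongr
  refine (enorm_integral_le_lintegral_enorm _).trans (setLIntegral_mono' measurableSet_Ioc ?_)
  intro s hs
  have hs' : ‖(1 - s : ℂ)‖ ≤ 1 := by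
    rw [← Complex.ofReal_one, ← Complex.ofReal_sub, Complex.norm_real, Real.norm_eq_abs, abs_le]
    constructor <;> linarith [hs.1, hs.2]
  rw [enorm_mul]
  exact mul_le_of_le_one_left' (by rwa [← ofReal_norm, ENNReal.ofReal_le_one])

lemma eLpNorm_slope_sub_deriv_le (hp : 1 ≤ p) (hF : ContDiff ℝ 2 F) {t : ℝ} (ht : t ≠ 0) :
    eLpNorm (fun u => (F (u + t) - F u) / t - deriv F u) p volume ≤
      ‖t‖ₑ * eLpNorm (deriv (deriv F)) p volume := by
  have hF₂ : Continuous (deriv (deriv F)) := (hF.deriv' : ContDiff ℝ 1 _).continuous_deriv le_rfl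
  refine (eLpNorm_le_mul_eLpNorm_of_ae_le_mul' (c := ‖t‖₊)
    (g := fun u => ∫⁻ s in Ioc (0 : ℝ) 1, ‖deriv (deriv F) (u + t * s)‖ₑ)
    (ae_of_all _ fun u => enorm_slope_sub_deriv_le hF u ht) p).trans ?_
  rw [← enorm_eq_nnnorm]
  gcongr
  exact eLpNorm_lintegral_translate_le hp hF₂ t

lemma memL_of_continuous (hF : Continuous F) (hF' : MemLp F p) : MemL p F :=
  ⟨hF'.1, (eLpNorm_logMeasure_of_continuous p hF).trans_lt hF'.eLpNorm_lt_top⟩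

lemma isGen_deriv (hp : 1 ≤ p) (hF : ContDiff ℝ 2 F) (h₀ : MemLp F p) (h₁ : MemLp (deriv F) p)
    (h₂ : MemLp (deriv (deriv F)) p) : IsGen p F (deriv F) := by
  have hcont : Continuous F := hF.continuous
  have hcont' : Continuous (deriv F) := (hF.deriv' : ContDiff ℝ 1 _).continuous
  refine ⟨memL_of_continuous hcont h₀, memL_of_continuous hcont' h₁, ?_⟩
  have hlim : Tendsto (fun t : ℝ => ‖t‖ₑ * eLpNorm (deriv (deriv F)) p volume) (𝓝[≠] 0) (𝓝 0) := by
    have : Tendsto (fun t : ℝ => ‖t‖ₑ) (𝓝[≠] 0) (𝓝 0) := by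
      simpa using (continuous_enorm.tendsto (0 : ℝ)).mono_left nhdsWithin_le_nhds
    simpa using ENNReal.Tendsto.mul_const this (Or.inr h₂.2.ne)
  refine tendsto_of_tendsto_of_tendsto_of_le_of_le' tendsto_const_nhds hlim
    (Eventually.of_forall fun _ => zero_le) ?_
  filter_upwards [self_mem_nhdsWithin] with t ht
  rw [eLpNorm_logMeasure_of_continuous p (by fun_prop)]
  exact eLpNorm_slope_sub_deriv_le hp hF ht

end derivative

/-! ### Series of translates -/

lemma eLpNorm_le_tsum_of_hasSum {α E ι : Type*} {m : MeasurableSpace α} {μ : Measure α}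
    [NormedAddCommGroup E] [Countable ι] {p : ℝ≥0∞} (hp : 1 ≤ p) {f : ι → α → E} {g : α → E}
    (hf : ∀ i, AEStronglyMeasurable (f i) μ) (hfg : ∀ᵐ x ∂μ, HasSum (fun i => f i x) (g x)) :
    eLpNorm g p μ ≤ ∑' i, eLpNorm (f i) p μ := by
  obtain ⟨s, hs⟩ := exists_seq_tendsto (atTop : Filter (Finset ι))
  calc eLpNorm g p μ
      ≤ liminf (fun n => eLpNorm (∑ i ∈ s n, f i) p μ) atTop := by
        refine Lp.eLpNorm_lim_le_liminf_eLpNorm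
          (fun n => Finset.aestronglyMeasurable_sum _ fun i _ => hf i) g ?_
        filter_upwards [hfg] with x hx
        simpa only [Finset.sum_apply, Function.comp_def] using Tendsto.comp hx hs
    _ ≤ ∑' i, eLpNorm (f i) p μ :=
        liminf_le_of_le (by isBoundedDefault) fun b hb => by
          obtain ⟨n, hn⟩ := hb.exists
          exact (hn.trans (eLpNorm_sum_le (fun i _ => hf i) hp)).trans (ENNReal.sum_le_tsum _)

lemma eventually_norm_le_of_tendstoUniformly_sum {ι α E : Type*} [SeminormedAddCommGroup E]
    {f : ι → α → E} {g : α → E} {ε : ℝ} (hε : 0 < ε)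
    (h : TendstoUniformly (fun (s : Finset ι) x => ∑ i ∈ s, f i x) g atTop) :
    ∀ᶠ i in cofinite, ∀ x, ‖f i x‖ < ε := by
  classical
  obtain ⟨s, hs⟩ := eventually_atTop.1 (Metric.tendstoUniformly_iff.1 h (ε / 2) (half_pos hε))
  refine s.finite_toSet.eventually_cofinite_notMem.mono fun i hi x => ?_
  have hterm : f i x = (g x - ∑ j ∈ s, f j x) - (g x - ∑ j ∈ insert i s, f j x) := by
    rw [Finset.sum_insert (by exact_mod_cast hi)]
    abel
  have h₀ := hs s le_rfl x
  have h₁ := hs (insert i s) (Finset.subset_insert i s) x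
  rw [dist_eq_norm] at h₀ h₁
  calc ‖f i x‖ ≤ ‖g x - ∑ j ∈ s, f j x‖ + ‖g x - ∑ j ∈ insert i s, f j x‖ :=
        hterm ▸ norm_sub_le _ _
    _ < ε := by linarith

section translates

variable {ι : Type*} {p : ℝ≥0∞} {c : ι → ℂ} {a : ι → ℝ} {F H : ℝ → ℂ}

lemma eLpNorm_le_of_hasSum_translates [Countable ι] (hp : 1 ≤ p)
    (hF : AEStronglyMeasurable F volume)
    (h : ∀ u, HasSum (fun i => c i * F (u + a i)) (H u)) :
    eLpNorm H p volume ≤ (∑' i, ‖c i‖ₑ) * eLpNorm F p volume := by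
  refine (eLpNorm_le_tsum_of_hasSum hp
    (fun i => (aestronglyMeasurable_translate hF (a i)).const_mul (c i)) (ae_of_all _ h)).trans ?_
  rw [← ENNReal.tsum_mul_right]
  refine ENNReal.tsum_le_tsum fun i => ?_
  rw [← eLpNorm_translate p volume F (a i)]
  exact eLpNorm_const_smul_le (c := c i)

lemma tendsto_eLpNorm_of_hasSum_translates [Countable ι] (hp : 1 ≤ p) (hF : MemLp F p)
    (hc : Summable fun i => ‖c i‖) (h : ∀ u, HasSum (fun i => c i * F (u + a i)) (H u)) :
    Tendsto (fun s : Finset ι => eLpNorm (fun u => (∑ i ∈ s, c i * F (u + a i)) - H u) p volume)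
      atTop (𝓝 0) := by
  have htail (s : Finset ι) : eLpNorm (fun u => (∑ i ∈ s, c i * F (u + a i)) - H u) p volume ≤
      (∑' i : {i // i ∉ s}, ‖c i‖ₑ) * eLpNorm F p volume := by
    rw [← eLpNorm_neg]
    refine eLpNorm_le_of_hasSum_translates (a := fun i : {i // i ∉ s} => a i) hp hF.1 fun u => ?_
    refine s.hasSum_compl_iff (f := fun i => c i * F (u + a i)).2 ?_
    simpa using h u
  have hlim := ENNReal.Tendsto.mul_const
    (ENNReal.tendsto_tsum_compl_atTop_zero (tsum_enorm_ne_top_iff_summable_norm.2 hc))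
    (Or.inr hF.eLpNorm_ne_top)
  rw [zero_mul] at hlim
  exact tendsto_of_tendsto_of_tendsto_of_le_of_le tendsto_const_nhds hlim (fun _ => zero_le) htail

lemma norm_mul_translate_le {M : ℝ} (hF : ∀ u, ‖F u‖ ≤ M) (i : ι) (u : ℝ) :
    ‖c i * F (u + a i)‖ ≤ ‖c i‖ * M := by
  rw [norm_mul]
  gcongr
  exact hF _

lemma summable_norm_translates {M : ℝ} (hF : ∀ u, ‖F u‖ ≤ M) (hc : Summable fun i => ‖c i‖)
    (u : ℝ) : Summable fun i => ‖c i * F (u + a i)‖ :=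
  (hc.mul_right M).of_nonneg_of_le (fun _ => norm_nonneg _) fun i => norm_mul_translate_le hF i u

lemma continuous_tsum_translates {M : ℝ} (hF : Continuous F) (hFM : ∀ u, ‖F u‖ ≤ M)
    (hc : Summable fun i => ‖c i‖) : Continuous fun u => ∑' i, c i * F (u + a i) :=
  continuous_tsum (fun i => by fun_prop) (hc.mul_right M) (norm_mul_translate_le hFM)

lemma tendstoUniformly_of_hasSum_translates {M : ℝ} (hF : ∀ u, ‖F u‖ ≤ M)
    (hc : Summable fun i => ‖c i‖) (h : ∀ u, HasSum (fun i => c i * F (u + a i)) (H u)) :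
    TendstoUniformly (fun (s : Finset ι) u => ∑ i ∈ s, c i * F (u + a i)) H atTop := by
  rw [← funext fun u => (h u).tsum_eq]
  exact tendstoUniformly_tsum (hc.mul_right M) (norm_mul_translate_le hF)

lemma exists_norm_le_of_tendstoUniformly [Infinite ι] (hc : ∀ i, c i ≠ 0)
    (h : TendstoUniformly (fun (s : Finset ι) u => ∑ i ∈ s, c i * F (u + a i)) H atTop) :
    ∃ M : ℝ≥0, ∀ u, ‖F u‖ ≤ M := by
  obtain ⟨i, hi⟩ := (eventually_norm_le_of_tendstoUniformly_sum one_pos h).exists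
  refine ⟨‖c i‖₊⁻¹, fun u => ?_⟩
  have hu := hi (u - a i)
  rw [sub_add_cancel, norm_mul] at hu
  rw [NNReal.coe_inv, coe_nnnorm, ← one_div, le_div_iff₀' (norm_pos_iff.2 (hc i))]
  exact hu.le

lemma hasSum_iteratedDeriv_of_hasSum_deriv {σ M : ℝ} (hF : ContDiff ℝ ∞ F) (hFM : ∀ u, ‖F u‖ ≤ M)
    (hc : HasSum (fun i => ‖c i‖) σ) (h : ∀ u, HasSum (fun i => c i * F (u + a i)) (deriv F u))
    (n : ℕ) (u : ℝ) :
    HasSum (fun i => c i * iteratedDeriv n F (u + a i)) (iteratedDeriv (n + 1) F u) := by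
  induction n generalizing F M u with
  | zero => simpa [iteratedDeriv_one] using h u
  | succ n ih =>
    have hF' : ContDiff ℝ ∞ (deriv F) := by
      simpa only [iteratedDeriv_one] using contDiff_iteratedDeriv hF 1
    have hF'M (u : ℝ) : ‖deriv F u‖ ≤ σ * M :=
      (h u).norm_le_of_bounded (hc.mul_right M) fun i => norm_mul_translate_le hFM i u
    simp only [iteratedDeriv_succ' (f := F)]
    refine ih hF' hF'M (fun u => ?_) u
    have hderiv (i : ι) (v : ℝ) :
        HasDerivAt (fun v => c i * F (v + a i)) (c i * deriv F (v + a i)) v :=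
      ((hF.differentiable (by simp) _).hasDerivAt.comp_add_const v (a i)).const_mul (c i)
    have hsum := hasDerivAt_tsum (hc.summable.mul_right (σ * M)) hderiv
      (norm_mul_translate_le hF'M) (h 0).summable u
    rw [funext fun v => (h v).tsum_eq] at hsum
    rw [hsum.deriv]
    exact (summable_norm_translates hF'M hc.summable u).of_norm.hasSum

lemma isBernstein_of_hasSum_deriv [Countable ι] {σ : ℝ≥0} {M : ℝ} (hp : 1 ≤ p)
    (hF : ContDiff ℝ ∞ F) (hFM : ∀ u, ‖F u‖ ≤ M) (hFp : MemLp F p)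
    (hc : HasSum (fun i => ‖c i‖) σ)
    (h : ∀ u, HasSum (fun i => c i * F (u + a i)) (deriv F u)) :
    IsBernstein p (eLpNorm F p volume).toNNReal σ F where
  contDiff := hF
  eLpNorm_le n := by
    have hσ : ∑' i, ‖c i‖ₑ = σ := by
      have := NNReal.hasSum_coe (f := fun i => ‖c i‖₊).1 hc
      exact (ENNReal.hasSum_coe.2 this).tsum_eq
    rw [ENNReal.coe_toNNReal hFp.eLpNorm_ne_top]
    induction n with
    | zero => simp
    | succ n ih =>
      calc eLpNorm (iteratedDeriv (n + 1) F) p volume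
          ≤ (∑' i, ‖c i‖ₑ) * eLpNorm (iteratedDeriv n F) p volume :=
            eLpNorm_le_of_hasSum_translates hp
              (contDiff_iteratedDeriv hF n).continuous.aestronglyMeasurable
              (hasSum_iteratedDeriv_of_hasSum_deriv hF hFM hc h n)
        _ ≤ σ * (eLpNorm F p volume * σ ^ n) := by rw [hσ]; gcongr
        _ = eLpNorm F p volume * σ ^ (n + 1) := by ring

end translates

/-! ### The Riesz–Boas series in the logarithmic variable -/

/-- The partial sum over `s` of the Riesz–Boas series of order `r`, in the logarithmic variable. -/
def rieszSum (σ : ℝ) (r : ℕ) (F : ℝ → ℂ) (s : Finset ℤ) (u : ℝ) : ℂ :=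
  ∑ k ∈ s, (rbCoeff σ r k : ℂ) * F (u + rbNode σ r k)

/-- Membership in the Bernstein space of the group of translations: `G` is represented by a smooth
function of exponential type `σ` whose derivatives are controlled by the norm of `G`. -/
def HasBernsteinRep (p : ℝ≥0∞) (σ : ℝ≥0) (G : ℝ → ℂ) : Prop :=
  ∃ F, G =ᵐ[logMeasure p] F ∧ IsBernstein p (eLpNorm G p (logMeasure p)).toNNReal σ F

section riesz

variable {p : ℝ≥0∞} {σ C : ℝ≥0} {F G G' H : ℝ → ℂ}

lemma continuous_rieszSum (σ : ℝ) (r : ℕ) (hF : Continuous F) (s : Finset ℤ) :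
    Continuous (rieszSum σ r F s) :=
  continuous_finsetSum s fun k _ => by fun_prop

lemma ae_eq_rieszSum (hGF : G =ᵐ[logMeasure p] F) (σ : ℝ) (r : ℕ) (s : Finset ℤ) :
    rieszSum σ r G s =ᵐ[logMeasure p] rieszSum σ r F s := by
  filter_upwards [ae_all_iff.2 fun k => ae_eq_logMeasure_translate hGF (rbNode σ r k)] with u hu
  simp only [rieszSum, hu]

lemma rbCoeff_one_ne_zero {σ : ℝ} (hσ : σ ≠ 0) (k : ℤ) : rbCoeff σ 1 k ≠ 0 := by
  simpa [rbCoeff, nodeCoeff_one, hσ, Real.pi_ne_zero, zpow_ne_zero] using half_sub_intCast_ne_zero k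

lemma hasSum_norm_rbCoeff_one (σ : ℝ≥0) : HasSum (fun k => ‖(rbCoeff σ 1 k : ℂ)‖) σ := by
  simpa using hasSum_abs_rbCoeff_one σ

lemma summable_norm_rbCoeff (σ : ℝ) (r : ℕ) : Summable fun k => ‖(rbCoeff σ r k : ℂ)‖ := by
  simpa using summable_abs_rbCoeff σ r

lemma eLpNorm_eq_of_ae_eq_continuous (hGF : G =ᵐ[logMeasure p] F) (hF : Continuous F) :
    eLpNorm G p (logMeasure p) = eLpNorm F p volume :=
  (eLpNorm_congr_ae hGF).trans (eLpNorm_logMeasure_of_continuous p hF)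

lemma IsGenPow.memL_right {k : ℕ} (h : IsGenPow p k G H) : MemL p H := by
  cases k with
  | zero => exact h.2.1
  | succ k =>
    obtain ⟨K, -, hKH⟩ := h
    exact hKH.2.1

lemma IsGenPow.congr_left {k : ℕ} (h : IsGenPow p k G H) (hG' : MemL p G')
    (hGG' : G =ᵐ[logMeasure p] G') : IsGenPow p k G' H := by
  induction k generalizing H with
  | zero => exact ⟨hG', h.2.1, hGG'.symm.trans h.2.2⟩
  | succ k ih =>
    obtain ⟨K, hK, hKH⟩ := h
    exact ⟨K, ih hK, hKH⟩

lemma IsBernstein.isGenPow (hp : 1 ≤ p) (hF : IsBernstein p C σ F) (k : ℕ) :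
    IsGenPow p k F (iteratedDeriv k F) := by
  induction k with
  | zero =>
    have hFp : MemL p F := memL_of_continuous hF.contDiff.continuous (hF.memLp_iteratedDeriv 0)
    exact ⟨hFp, hFp, .rfl⟩
  | succ k ih =>
    refine ⟨iteratedDeriv k F, ih, ?_⟩
    rw [iteratedDeriv_succ]
    refine isGen_deriv hp (contDiff_infty.1 (contDiff_iteratedDeriv hF.contDiff k) 2)
      (hF.memLp_iteratedDeriv k) ?_ ?_ <;> simp only [← iteratedDeriv_succ]
    exacts [hF.memLp_iteratedDeriv _, hF.memLp_iteratedDeriv _]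

lemma hasBernsteinRep_iff_isGenPow (hp : 1 ≤ p) (hG : MemL p G) :
    HasBernsteinRep p σ G ↔ ∀ k, ∃ H, IsGenPow p k G H ∧
      eLpNorm H p (logMeasure p) ≤ σ ^ k * eLpNorm G p (logMeasure p) := by
  have hnorm : ((eLpNorm G p (logMeasure p)).toNNReal : ℝ≥0∞) = eLpNorm G p (logMeasure p) :=
    ENNReal.coe_toNNReal hG.2.ne
  constructor
  · rintro ⟨F, hGF, hF⟩ k
    refine ⟨iteratedDeriv k F, (hF.isGenPow hp k).congr_left hG hGF.symm, ?_⟩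
    rw [eLpNorm_logMeasure_of_continuous p (hF.continuous_iteratedDeriv k), mul_comm]
    exact (hF.eLpNorm_le k).trans_eq (by rw [hnorm])
  · intro h
    obtain ⟨F, hF, hGF, hiter⟩ := exists_smooth_representative hp fun k =>
      (h k).imp fun _ => And.left
    refine ⟨F, hGF, hF, fun k => ?_⟩
    obtain ⟨H, hGH, hH⟩ := h k
    rw [hnorm, mul_comm, ← eLpNorm_eq_of_ae_eq_continuous (hiter k H hGH)
      (contDiff_iteratedDeriv hF k).continuous]
    exact hH

lemma HasBernsteinRep.tendsto_rieszSum (hp : 1 ≤ p) (hσ : σ ≠ 0) (hG : MemL p G)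
    (h : HasBernsteinRep p σ G) (r : ℕ) :
    ∃ H, IsGenPow p r G H ∧
      Tendsto (fun s => eLpNorm (fun u => rieszSum σ r G s u - H u) p (logMeasure p))
        atTop (𝓝 0) := by
  obtain ⟨F, hGF, hF⟩ := h
  refine ⟨iteratedDeriv r F, (hF.isGenPow hp r).congr_left hG hGF.symm, ?_⟩
  refine (tendsto_eLpNorm_of_hasSum_translates hp (hF.memLp_iteratedDeriv 0)
    (summable_norm_rbCoeff σ r) (hasSum_rbCoeff (hF.top hp) hσ r)).congr fun s => ?_
  refine (eLpNorm_eq_of_ae_eq_continuous ((ae_eq_rieszSum hGF σ r s).sub .rfl) ?_).symm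
  exact (continuous_rieszSum σ r hF.contDiff.continuous s).sub (hF.continuous_iteratedDeriv r)

lemma HasBernsteinRep.tendstoUniformly_rieszSum (hp : 1 ≤ p) (hσ : σ ≠ 0)
    (h : HasBernsteinRep p σ G) :
    ∃ F, G =ᵐ[logMeasure p] F ∧ ContDiff ℝ ∞ F ∧ ∀ r,
      (∀ u, Summable fun k => ‖(rbCoeff σ r k : ℂ) * F (u + rbNode σ r k)‖) ∧
        TendstoUniformly (rieszSum σ r F) (iteratedDeriv r F) atTop := by
  obtain ⟨F, hGF, hF⟩ := h
  have hbound := (hF.top hp).norm_le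
  exact ⟨F, hGF, hF.contDiff, fun r =>
    ⟨summable_norm_translates hbound (summable_norm_rbCoeff σ r),
      tendstoUniformly_of_hasSum_translates hbound (summable_norm_rbCoeff σ r)
        (hasSum_rbCoeff (hF.top hp) hσ r)⟩⟩

lemma hasBernsteinRep_of_hasSum_deriv (hp : 1 ≤ p) (hG : MemL p G) (hGF : G =ᵐ[logMeasure p] F)
    (hF : ContDiff ℝ ∞ F) {M : ℝ} (hFM : ∀ u, ‖F u‖ ≤ M)
    (h : ∀ u, HasSum (fun k => (rbCoeff σ 1 k : ℂ) * F (u + rbNode σ 1 k)) (deriv F u)) :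
    HasBernsteinRep p σ G := by
  have hnorm := eLpNorm_eq_of_ae_eq_continuous hGF hF.continuous
  refine ⟨F, hGF, hnorm ▸ ?_⟩
  exact isBernstein_of_hasSum_deriv hp hF hFM
    ⟨hF.continuous.aestronglyMeasurable, hnorm ▸ hG.2⟩ (hasSum_norm_rbCoeff_one σ) h

lemma hasSum_deriv_of_tendsto_rieszSum (hp : 1 ≤ p) (hF : ContDiff ℝ ∞ F) (hFp : MemLp F p)
    {M : ℝ} (hFM : ∀ u, ‖F u‖ ≤ M)
    (h : Tendsto (fun s => eLpNorm (fun u => rieszSum σ 1 F s u - deriv F u) p (logMeasure p))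
      atTop (𝓝 0)) (u : ℝ) :
    HasSum (fun k => (rbCoeff σ 1 k : ℂ) * F (u + rbNode σ 1 k)) (deriv F u) := by
  have hc := summable_norm_rbCoeff σ 1
  have hsum (u : ℝ) := (summable_norm_translates (a := rbNode σ 1) hFM hc u).of_norm.hasSum
  have hcont := continuous_tsum_translates (a := rbNode σ 1) hF.continuous hFM hc
  have hcont' : Continuous (deriv F) := hF.continuous_deriv (by simp)
  have hlim : Tendsto (fun s => eLpNorm (fun u => rieszSum σ 1 F s u -
      ∑' k, (rbCoeff σ 1 k : ℂ) * F (u + rbNode σ 1 k)) p (logMeasure p)) atTop (𝓝 0) :=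
    (tendsto_eLpNorm_of_hasSum_translates hp hFp hc hsum).congr fun s =>
      (eLpNorm_logMeasure_of_continuous p
        ((continuous_rieszSum σ 1 hF.continuous s).sub hcont)).symm
  have heq := eq_of_ae_eq_logMeasure (ae_eq_logMeasure_of_tendsto hp
    (fun s => (continuous_rieszSum σ 1 hF.continuous s).aestronglyMeasurable)
    hcont.aestronglyMeasurable hcont'.aestronglyMeasurable hlim h) hcont hcont'
  exact congrFun heq u ▸ hsum u

lemma hasBernsteinRep_iff_tendsto_rieszSum (hp : 1 ≤ p) (hσ : σ ≠ 0) (hG : MemL p G) :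
    HasBernsteinRep p σ G ↔ ∀ r : ℕ, 1 ≤ r → ∃ H, IsGenPow p r G H ∧
      Tendsto (fun s => eLpNorm (fun u => rieszSum σ r G s u - H u) p (logMeasure p))
        atTop (𝓝 0) := by
  refine ⟨fun h r _ => h.tendsto_rieszSum hp hσ hG r, fun h => ?_⟩
  have hpow (k : ℕ) : ∃ H, IsGenPow p k G H := by
    rcases k.eq_zero_or_pos with rfl | hk
    · exact ⟨G, hG, hG, .rfl⟩
    · exact (h k hk).imp fun _ => And.left
  obtain ⟨F, hF, hGF, hiter⟩ := exists_smooth_representative hp hpow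
  obtain ⟨H, hGH, hH⟩ := h 1 le_rfl
  have hF' : Continuous (deriv F) := hF.continuous_deriv (by simp)
  have hHF : H =ᵐ[logMeasure p] deriv F := iteratedDeriv_one (f := F) ▸ hiter 1 H hGH
  have hFp : MemLp F p := ⟨hF.continuous.aestronglyMeasurable,
    eLpNorm_eq_of_ae_eq_continuous hGF hF.continuous ▸ hG.2⟩
  have hderiv : eLpNorm (deriv F) p volume ≠ ⊤ := by
    obtain ⟨K, -, hKH⟩ := hGH
    exact eLpNorm_eq_of_ae_eq_continuous hHF hF' ▸ hKH.2.1.2.ne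
  have hfin : eLpNorm F p volume + eLpNorm (deriv F) p volume ≠ ⊤ :=
    ENNReal.add_ne_top.2 ⟨hFp.eLpNorm_ne_top, hderiv⟩
  have hbound (u : ℝ) : ‖F u‖ ≤ (eLpNorm F p volume + eLpNorm (deriv F) p volume).toReal := by
    rw [← toReal_enorm]
    exact ENNReal.toReal_mono hfin
      (enorm_le_eLpNorm_add_eLpNorm_deriv hp (hF.of_le (by simp)) u)
  refine hasBernsteinRep_of_hasSum_deriv hp hG hGF hF hbound
    (hasSum_deriv_of_tendsto_rieszSum hp hF hFp hbound (hH.congr fun s => ?_))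
  exact eLpNorm_congr_ae ((ae_eq_rieszSum hGF σ 1 s).sub hHF)

lemma hasBernsteinRep_iff_tendstoUniformly_rieszSum (hp : 1 ≤ p) (hσ : σ ≠ 0) (hG : MemL p G) :
    HasBernsteinRep p σ G ↔ ∃ F, G =ᵐ[logMeasure p] F ∧ ContDiff ℝ ∞ F ∧ ∀ r : ℕ, 1 ≤ r →
      (∀ u, Summable fun k => ‖(rbCoeff σ r k : ℂ) * F (u + rbNode σ r k)‖) ∧
        TendstoUniformly (rieszSum σ r F) (iteratedDeriv r F) atTop := by
  constructor
  · intro h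
    obtain ⟨F, hGF, hF, hseries⟩ := h.tendstoUniformly_rieszSum hp hσ
    exact ⟨F, hGF, hF, fun r _ => hseries r⟩
  · rintro ⟨F, hGF, hF, hseries⟩
    have huniform := (hseries 1 le_rfl).2
    rw [iteratedDeriv_one] at huniform
    have hσ' : (σ : ℝ) ≠ 0 := NNReal.coe_ne_zero.2 hσ
    obtain ⟨M, hM⟩ := exists_norm_le_of_tendstoUniformly
      (fun k => Complex.ofReal_ne_zero.2 (rbCoeff_one_ne_zero hσ' k)) huniform
    exact hasBernsteinRep_of_hasSum_deriv hp hG hGF hF hM huniform.tendsto_at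

end riesz

/-! ### The substitution `x = exp u` -/

lemma quasiMeasurePreserving_exp :
    Measure.QuasiMeasurePreserving Real.exp volume (volume.restrict (Ioi 0)) := by
  refine ⟨Real.measurable_exp, Measure.AbsolutelyContinuous.mk fun s hs hs₀ => ?_⟩
  rw [Measure.restrict_apply hs] at hs₀
  have hpreimage : Real.exp ⁻¹' s ⊆ Real.log '' (s ∩ Ioi 0) := fun u hu =>
    ⟨Real.exp u, ⟨hu, Real.exp_pos u⟩, Real.log_exp u⟩
  rw [Measure.map_apply Real.measurable_exp hs]
  refine measure_mono_null hpreimage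
    (addHaar_image_eq_zero_of_differentiableOn_of_addHaar_eq_zero volume (fun x hx => ?_) hs₀)
  exact (Real.differentiableAt_log (ne_of_gt hx.2)).differentiableWithinAt

lemma quasiMeasurePreserving_log :
    Measure.QuasiMeasurePreserving Real.log (volume.restrict (Ioi 0)) volume := by
  refine ⟨Real.measurable_log, Measure.AbsolutelyContinuous.mk fun s hs hs₀ => ?_⟩
  have hpreimage : Real.log ⁻¹' s ∩ Ioi 0 ⊆ Real.exp '' s := fun x hx =>
    ⟨Real.log x, hx.1, Real.exp_log hx.2⟩
  rw [Measure.map_apply Real.measurable_log hs, Measure.restrict_apply (Real.measurable_log hs)]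
  exact measure_mono_null hpreimage
    (addHaar_image_eq_zero_of_differentiableOn_of_addHaar_eq_zero volume
      Real.differentiable_exp.differentiableOn hs₀)

section transfer

variable {p : ℝ≥0∞} {σ : ℝ≥0} {f g F : ℝ → ℂ}

lemma aestronglyMeasurable_comp_exp_iff :
    AEStronglyMeasurable (f ∘ Real.exp) volume ↔
      AEStronglyMeasurable f (volume.restrict (Ioi 0)) := by
  refine ⟨fun h => ?_, fun h => h.comp_quasiMeasurePreserving quasiMeasurePreserving_exp⟩
  refine (h.comp_quasiMeasurePreserving quasiMeasurePreserving_log).congr ?_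
  filter_upwards [ae_restrict_mem measurableSet_Ioi] with x hx
  simp only [Function.comp_apply, Real.exp_log hx]

lemma ofReal_exp_mul_enorm_rpow {q : ℝ} (hq : 0 < q) (u : ℝ) :
    ENNReal.ofReal |Real.exp u| * ‖((Real.exp u ^ (-(1 / q)) : ℝ) : ℂ)‖ₑ ^ q = 1 := by
  have hexp := Real.exp_pos u
  rw [← ofReal_norm, Complex.norm_real, Real.norm_of_nonneg (by positivity),
    ENNReal.ofReal_rpow_of_nonneg (by positivity) hq.le, ← ENNReal.ofReal_mul (by positivity),
    abs_of_pos hexp, ← Real.rpow_mul hexp.le, neg_mul, one_div_mul_cancel hq.ne',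
    Real.rpow_neg_one, mul_inv_cancel₀ hexp.ne', ENNReal.ofReal_one]

lemma xNorm_eq_eLpNorm (hp : 1 ≤ p) (f : ℝ → ℂ) :
    XNorm p f = eLpNorm (f ∘ Real.exp) p (logMeasure p) := by
  rcases eq_or_ne p ∞ with rfl | hp'
  · rw [XNorm, if_pos rfl, eLpNorm_logMeasure_top, ← Real.range_exp, iSup_range]
    rfl
  have hp₀ : p ≠ 0 := (one_pos.trans_le hp).ne'
  have hpos : 0 < p.toReal := ENNReal.toReal_pos hp₀ hp'
  have hsubst (g : ℝ → ℝ≥0∞) :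
      ∫⁻ x in Ioi 0, g x = ∫⁻ u, ENNReal.ofReal |Real.exp u| * g (Real.exp u) := by
    simpa only [image_univ, Real.range_exp, Measure.restrict_univ] using
      lintegral_image_eq_lintegral_abs_deriv_mul MeasurableSet.univ
        (fun x _ => (Real.hasDerivAt_exp x).hasDerivWithinAt) Real.exp_injective.injOn g
  rw [XNorm, if_neg hp', logMeasure_of_ne_top hp',
    eLpNorm_eq_lintegral_rpow_enorm_toReal hp₀ hp', eLpNorm_eq_lintegral_rpow_enorm_toReal hp₀ hp',
    hsubst]
  congr 1
  refine lintegral_congr fun u => ?_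
  rw [enorm_mul, ENNReal.mul_rpow_of_nonneg _ _ hpos.le, mul_left_comm,
    ofReal_exp_mul_enorm_rpow hpos, mul_one, Function.comp_apply]

lemma memX_iff (hp : 1 ≤ p) : MemX p f ↔ MemL p (f ∘ Real.exp) := by
  rw [MemX, MemL, xNorm_eq_eLpNorm hp, aestronglyMeasurable_comp_exp_iff]

lemma xEq_iff (hp : 1 ≤ p) (hf : AEStronglyMeasurable f (volume.restrict (Ioi 0)))
    (hg : AEStronglyMeasurable g (volume.restrict (Ioi 0))) :
    XEq p f g ↔ f ∘ Real.exp =ᵐ[logMeasure p] g ∘ Real.exp := by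
  rw [XEq, xNorm_eq_eLpNorm hp]
  exact eLpNorm_logMeasure_sub_eq_zero_iff (one_pos.trans_le hp).ne'
    (aestronglyMeasurable_comp_exp_iff.2 hf) (aestronglyMeasurable_comp_exp_iff.2 hg)

lemma isTheta_iff (hp : 1 ≤ p) : IsTheta p f g ↔ IsGen p (f ∘ Real.exp) (g ∘ Real.exp) := by
  rw [IsTheta, IsGen, memX_iff hp, memX_iff hp]
  simp only [xNorm_eq_eLpNorm hp, mellinShift, Function.comp_def, ← Real.exp_add, add_comm]

lemma exists_comp_exp_iff {P : (ℝ → ℂ) → Prop} : (∃ g, P (g ∘ Real.exp)) ↔ ∃ G, P G :=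
  Real.exp_injective.surjective_comp_right.exists.symm

lemma isThetaPow_iff (hp : 1 ≤ p) (k : ℕ) :
    IsThetaPow p k f g ↔ IsGenPow p k (f ∘ Real.exp) (g ∘ Real.exp) := by
  induction k generalizing g with
  | zero =>
    simp only [IsThetaPow, IsGenPow, ← memX_iff hp]
    exact and_congr_right fun hf => and_congr_right fun hg => xEq_iff hp hf.1 hg.1
  | succ k ih =>
    simp only [IsThetaPow, IsGenPow, ih, isTheta_iff hp]
    exact exists_comp_exp_iff
      (P := fun K => IsGenPow p k (f ∘ Real.exp) K ∧ IsGen p K (g ∘ Real.exp))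

lemma memBernstein_iff (hp : 1 ≤ p) (hf : MemX p f) :
    MemBernstein σ p f ↔ HasBernsteinRep p σ (f ∘ Real.exp) := by
  rw [hasBernsteinRep_iff_isGenPow hp ((memX_iff hp).1 hf)]
  simp only [MemBernstein, hf, true_and, isThetaPow_iff hp, xNorm_eq_eLpNorm hp,
    ENNReal.ofReal_pow σ.coe_nonneg, ENNReal.ofReal_coe_nnreal]
  exact forall_congr' fun k => exists_comp_exp_iff (P := fun H =>
    IsGenPow p k (f ∘ Real.exp) H ∧
      eLpNorm H p (logMeasure p) ≤ σ ^ k * eLpNorm (f ∘ Real.exp) p (logMeasure p))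

lemma iteratedDeriv_two_mul_sincN_zero (m : ℕ) :
    iteratedDeriv (2 * m) sincN 0 = (-1) ^ m * (π ^ (2 * m) / (2 * (m : ℝ) + 1)) := by
  have hpow (v : ℝ) : (I * v) ^ (2 * m) * Complex.exp (I * v * (0 : ℝ)) =
      (((-1) ^ m * v ^ (2 * m) : ℝ) : ℂ) := by
    simp [mul_pow, pow_mul I]
  have h := iteratedDeriv_sincN (2 * m) 0
  simp only [hpow] at h
  rw [intervalIntegral.integral_ofReal, intervalIntegral.integral_const_mul, integral_pow,
    (odd_two_mul_add_one m).neg_pow] at h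
  norm_cast at h
  rw [h]
  have := Real.pi_ne_zero
  push_cast
  field_simp
  ring

lemma zpow_mul_coeffA (m : ℕ) (k : ℤ) :
    (-1) ^ (k + 1) * coeffA m k = iteratedDeriv (2 * m - 1) sincN (1 / 2 - k) := by
  rw [coeffA, ← mul_assoc, ← mul_zpow]
  simp

lemma zpow_mul_coeffB (m : ℕ) (k : ℤ) :
    (-1) ^ (k + 1) * coeffB m k = iteratedDeriv (2 * m) sincN (-k) := by
  rw [coeffB]
  split_ifs with hk
  · rw [hk, Int.cast_zero, neg_zero, iteratedDeriv_two_mul_sincN_zero, zero_add, zpow_one]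
    ring
  · rw [← mul_assoc, ← mul_zpow]
    simp

lemma rieszTerm_exp (r : ℕ) (σ : ℝ) (f : ℝ → ℂ) (k : ℤ) (u : ℝ) :
    rieszTerm r σ f k (Real.exp u) =
      (rbCoeff σ r k : ℂ) * (f ∘ Real.exp) (u + rbNode σ r k) := by
  rw [rieszTerm, rbCoeff, nodeCoeff, rbNode, node, nodeShift]
  split_ifs with h
  · have hr' : 2 * ((r + 1) / 2) - 1 = r := by grind
    rw [termOdd, zpow_mul_coeffA, hr', ← Real.exp_add, add_comm u, neg_sub, Function.comp_apply]
  · have hr' : 2 * (r / 2) = r := by grind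
    rw [termEven, zpow_mul_coeffB, hr', ← Real.exp_add, add_comm u, sub_zero, mul_div_right_comm,
      Function.comp_apply]

lemma sum_rieszTerm_exp (r : ℕ) (σ : ℝ) (f : ℝ → ℂ) (s : Finset ℤ) (u : ℝ) :
    ∑ k ∈ s, rieszTerm r σ f k (Real.exp u) = rieszSum σ r (f ∘ Real.exp) s u := by
  simp only [rieszTerm_exp, rieszSum]

lemma exists_isThetaPow_isRieszBoas_iff (hp : 1 ≤ p) (r : ℕ) :
    (∃ g, IsThetaPow p r f g ∧ IsRieszBoas p r σ f g) ↔
      ∃ H, IsGenPow p r (f ∘ Real.exp) H ∧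
        Tendsto (fun s => eLpNorm (fun u => rieszSum σ r (f ∘ Real.exp) s u - H u) p (logMeasure p))
          atTop (𝓝 0) := by
  refine (exists_congr fun g => ?_).trans exists_comp_exp_iff
  rw [isThetaPow_iff hp, IsRieszBoas, memX_iff hp]
  simp only [xNorm_eq_eLpNorm hp, Function.comp_def, sum_rieszTerm_exp]
  exact and_congr_right fun (h : IsGenPow p r _ _) => and_iff_right h.memL_right

lemma contDiff_comp_exp_iff : ContDiff ℝ ∞ (F ∘ Real.exp) ↔ ContDiffOn ℝ ∞ F (Ioi 0) := by
  refine ⟨fun h => ?_, fun h => ?_⟩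
  · have hlog := h.comp_contDiffOn (Real.contDiffOn_log.mono fun x hx => ne_of_gt hx)
    refine hlog.congr fun x (hx : 0 < x) => ?_
    simp only [Function.comp_apply, Real.exp_log hx]
  · exact contDiffOn_univ.1 (h.comp Real.contDiff_exp.contDiffOn fun u _ => Real.exp_pos u)

lemma contDiffOn_iterate_xddx (hF : ContDiffOn ℝ ∞ F (Ioi 0)) (r : ℕ) :
    ContDiffOn ℝ ∞ (xddx^[r] F) (Ioi 0) := by
  induction r with
  | zero => exact hF
  | succ r ih =>
    rw [Function.iterate_succ_apply']
    exact Complex.ofRealCLM.contDiff.contDiffOn.mul (ih.deriv_of_isOpen isOpen_Ioi (by simp))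

lemma iterate_xddx_comp_exp (hF : ContDiffOn ℝ ∞ F (Ioi 0)) (r : ℕ) :
    xddx^[r] F ∘ Real.exp = iteratedDeriv r (F ∘ Real.exp) := by
  induction r with
  | zero => simp
  | succ r ih =>
    ext u
    have hdiff : DifferentiableAt ℝ (xddx^[r] F) (Real.exp u) :=
      ((contDiffOn_iterate_xddx hF r).differentiableOn (by simp)).differentiableAt
        (Ioi_mem_nhds (Real.exp_pos u))
    rw [iteratedDeriv_succ, ← ih, (hdiff.hasDerivAt.scomp u (Real.hasDerivAt_exp u)).deriv,
      Function.iterate_succ', Function.comp_apply, Function.comp_apply, xddx, Complex.real_smul]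

lemma tendstoUniformlyOn_Ioi_iff {ι : Type*} {l : Filter ι} {S : ι → ℝ → ℂ} {T : ℝ → ℂ} :
    TendstoUniformlyOn S T l (Ioi 0) ↔
      TendstoUniformly (fun i => S i ∘ Real.exp) (T ∘ Real.exp) l := by
  simp only [TendstoUniformlyOn, TendstoUniformly, ← Real.range_exp, forall_mem_range,
    Function.comp_apply]

lemma xEq_and_contDiffOn_and_tendstoUniformlyOn_iff (hp : 1 ≤ p) (hf : MemX p f) :
    (XEq p f F ∧ ContDiffOn ℝ ∞ F (Ioi 0) ∧ ∀ r : ℕ, 1 ≤ r →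
      (∀ x ∈ Ioi (0 : ℝ), Summable fun k : ℤ => ‖rieszTerm r σ F k x‖) ∧
        TendstoUniformlyOn (fun (s : Finset ℤ) x => ∑ k ∈ s, rieszTerm r σ F k x)
          (xddx^[r] F) atTop (Ioi 0)) ↔
    f ∘ Real.exp =ᵐ[logMeasure p] F ∘ Real.exp ∧ ContDiff ℝ ∞ (F ∘ Real.exp) ∧ ∀ r : ℕ, 1 ≤ r →
      (∀ u, Summable fun k => ‖(rbCoeff σ r k : ℂ) * (F ∘ Real.exp) (u + rbNode σ r k)‖) ∧
        TendstoUniformly (rieszSum σ r (F ∘ Real.exp)) (iteratedDeriv r (F ∘ Real.exp)) atTop := by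
  rw [contDiff_comp_exp_iff, and_left_comm, and_left_comm (b := ContDiffOn _ _ _ _)]
  refine and_congr_right fun hF => and_congr ?_ (forall₂_congr fun r _ => and_congr ?_ ?_)
  · exact xEq_iff hp hf.1 (hF.continuousOn.aestronglyMeasurable measurableSet_Ioi)
  · simp only [← Real.range_exp, forall_mem_range, rieszTerm_exp]
  · rw [tendstoUniformlyOn_Ioi_iff, iterate_xddx_comp_exp hF]
    simp only [Function.comp_def, sum_rieszTerm_exp]

end transfer

end MellinBernstein

end

open MellinBernstein in
open scoped ENNReal ContDiff in
theorem mainTheorem3 (p : ℝ≥0∞) (hp : 1 ≤ p) (σ : ℝ) (hσ : 0 < σ) (f : ℝ → ℂ)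
    (hf : MemX p f) :
    (MemBernstein σ p f ↔
      ∀ r : ℕ, 1 ≤ r → ∃ g : ℝ → ℂ, IsThetaPow p r f g ∧ IsRieszBoas p r σ f g) ∧
    (MemBernstein σ p f ↔
      ∃ F : ℝ → ℂ, XEq p f F ∧ ContDiffOn ℝ ∞ F (Ioi 0) ∧
        ∀ r : ℕ, 1 ≤ r →
          (∀ x ∈ Ioi (0 : ℝ), Summable (fun k : ℤ => ‖rieszTerm r σ F k x‖)) ∧
          TendstoUniformlyOn (fun (s : Finset ℤ) (x : ℝ) => ∑ k ∈ s, rieszTerm r σ F k x)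
            (xddx^[r] F) atTop (Ioi 0)) := by
  lift σ to NNReal using hσ.le
  have hσ₀ : σ ≠ 0 := (NNReal.coe_pos.1 hσ).ne'
  have hG : MemL p (f ∘ Real.exp) := (memX_iff hp).1 hf
  rw [memBernstein_iff hp hf]
  constructor
  · rw [hasBernsteinRep_iff_tendsto_rieszSum hp hσ₀ hG]
    exact forall₂_congr fun r _ => (exists_isThetaPow_isRieszBoas_iff hp r).symm
  · rw [hasBernsteinRep_iff_tendstoUniformly_rieszSum hp hσ₀ hG, ← exists_comp_exp_iff]
    exact exists_congr fun F => (xEq_and_contDiffOn_and_tendstoUniformlyOn_iff hp hf).symm
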